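/- Let $d\in\mathbb N$, let $g:\mathbb R\to\mathbb R$ be real analytic, let $f:\mathbb T^d\to\mathbb R$, with $\mathbb T=\mathbb R/2\pi\mathbb Z$, be a real-valued trigonometric polynomial with average $f_0=(2\pi)^{-d}\int_{\mathbb T^d}f(\psi)\,d\psi$, and let $c_0\in\mathbb R$ satisfy $g(c_0)=f_0$ and $a:=g'(c_0)>0$. Let $\omega\in\mathbb R^d$ be any vector with rationally independent components, i.e. $\omega\cdot\nu\neq0$ for all $\nu\in\mathbb Z^d\setminus\{0\}$. Then there are constants $\varepsilon_0>0$ and $C$ (depending on $f,g,c_0,\omega$) such that for every $\varepsilon\in(0,\varepsilon_0]$ the equation $$\varepsilon\ddot x+\dot x+\varepsilon\,g(x)=\varepsilon\,f(\omega t)$$ has a quasi-periodic solution $x_0(t)=c_0+u(\omega t)$, $t\in\mathbb R$, with $u:\mathbb T^d\to\mathbb R$ real analytic and $|u|\le C\varepsilon$ (so it has the same frequency vector as $f$), which is a local attractor and is locally unique. That is, there is a simply connected open set $U\subset\mathbb R^2$ in the phase space of pairs $(x,\dot x)$ such that $(x_0(t),\dot x_0(t))\in U$ for all $t$; for every initial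 time $t_0\in\mathbb R$ and every initial datum in $U$ at time $t_0$ the corresponding solution $x$ exists for all $t\ge t_0$ and satisfies $x(t)-x_0(t)\to0$ and $\dot x(t)-\dot x_0(t)\to0$ as $t\to+\infty$; and $x_0$ is the only quasi-periodic solution (of the form $h(\omega' t)$ with $h$ continuous on a torus $\mathbb T^n$ and $\omega'\in\mathbb R^n$, for any $n$) whose trajectory $(x(t),\dot x(t))$ meets $U$ at some time. -/

import Mathlib

open MeasureTheory Filter Topology

noncomputable section

namespace DampedForced

/-- Functions on the torus `(ℝ/2πℤ)^d` are functions on `ℝ^d` that are `2π`-periodic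
in every variable. -/
def TorusPeriodic {d : ℕ} (h : (Fin d → ℝ) → ℝ) : Prop :=
  ∀ (ψ : Fin d → ℝ) (k : Fin d → ℤ), h (fun i => ψ i + 2 * Real.pi * (k i : ℝ)) = h ψ

/-- A real-valued trigonometric polynomial `f(ψ) = ∑_ν c_ν e^{i ν·ψ}` (finite sum over `ℤ^d`). -/
def IsTrigPolynomial {d : ℕ} (f : (Fin d → ℝ) → ℝ) : Prop :=
  ∃ c : (Fin d → ℤ) →₀ ℂ, ∀ ψ : Fin d → ℝ,
    (f ψ : ℂ) = ∑ ν ∈ c.support,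
      c ν * Complex.exp (Complex.I * ((∑ i, (ν i : ℝ) * ψ i : ℝ) : ℂ))

/-- The zeroth Fourier coefficient: the average of `f` over `[0,2π]^d`. -/
def torusMean {d : ℕ} (f : (Fin d → ℝ) → ℝ) : ℝ :=
  ⨍ ψ in Set.Icc (0 : Fin d → ℝ) (fun _ => 2 * Real.pi), f ψ

/-- The components of `ω` are rationally independent: `ω·ν ≠ 0` for all nonzero `ν ∈ ℤ^d`. -/
def NonResonant {d : ℕ} (ω : Fin d → ℝ) : Prop :=
  ∀ ν : Fin d → ℤ, ν ≠ 0 → ∑ i, ω i * (ν i : ℝ) ≠ 0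

/-- On the time set `J`, the function `x` is twice differentiable with velocity `v` and satisfies
`ε x'' + x' + ε g(x) = ε f(ω t)`. At an endpoint of `J` the derivatives are one-sided. -/
def IsSolutionOn {d : ℕ} (ε : ℝ) (g : ℝ → ℝ) (f : (Fin d → ℝ) → ℝ) (ω : Fin d → ℝ)
    (J : Set ℝ) (x v : ℝ → ℝ) : Prop :=
  ∀ t ∈ J, HasDerivWithinAt x (v t) J t ∧
    ∃ w : ℝ, HasDerivWithinAt v w J t ∧ ε * w + v t + ε * g (x t) = ε * f (t • ω)

/-- A function `t ↦ h(ω t)` with `h` continuous on a torus of some dimension `n` and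
`ω ∈ ℝ^n` any frequency vector. -/
def IsQuasiPeriodic (x : ℝ → ℝ) : Prop :=
  ∃ (n : ℕ) (ω : Fin n → ℝ) (h : (Fin n → ℝ) → ℝ),
    Continuous h ∧ TorusPeriodic h ∧ ∀ t, x t = h (t • ω)

/-- The phase-space set `U` witnesses that the solution `(x₀, v₀)` is a local attractor: `U` is open
and simply connected, it contains the whole solution, and, whatever the initial time `t₀`, every
trajectory starting in `U` exists for all `t ≥ t₀` and tends to the solution. -/
structure IsAttractedSet {d : ℕ} (ε : ℝ) (g : ℝ → ℝ) (f : (Fin d → ℝ) → ℝ) (ω : Fin d → ℝ)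
    (x₀ v₀ : ℝ → ℝ) (U : Set (ℝ × ℝ)) : Prop where
  isOpen : IsOpen U
  simplyConnected : IsSimplyConnected U
  mem : ∀ t, (x₀ t, v₀ t) ∈ U
  exists_forward : ∀ (t₀ : ℝ), ∀ p ∈ U, ∃ x v : ℝ → ℝ,
    IsSolutionOn ε g f ω (Set.Ici t₀) x v ∧ (x t₀, v t₀) = p
  tendsto : ∀ (t₀ : ℝ) (x v : ℝ → ℝ), IsSolutionOn ε g f ω (Set.Ici t₀) x v →
    (x t₀, v t₀) ∈ U →
      Tendsto (fun t => x t - x₀ t) atTop (𝓝 0) ∧ Tendsto (fun t => v t - v₀ t) atTop (𝓝 0)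

/-- The solution `(x₀, v₀)` is the only quasi-periodic solution whose trajectory meets `U`. -/
def IsUniqueQuasiPeriodicIn {d : ℕ} (ε : ℝ) (g : ℝ → ℝ) (f : (Fin d → ℝ) → ℝ) (ω : Fin d → ℝ)
    (x₀ : ℝ → ℝ) (U : Set (ℝ × ℝ)) : Prop :=
  ∀ x v : ℝ → ℝ, IsSolutionOn ε g f ω Set.univ x v → IsQuasiPeriodic x →
    (∃ t, (x t, v t) ∈ U) → x = x₀

end DampedForced

end

noncomputable section

namespace DampedForced

open scoped BoundedContinuousFunction NNReal

/-! Dividing by `ε` and putting `κ = 1/ε`, `x = c₀ + y` turns the equation into `y'' + κ y' + a y =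
F - G(y)`, where `F` is the forcing minus its mean and `G` is the nonlinear remainder of `g` at
`c₀`, extended to a globally `a/2`-Lipschitz function. For small `ε` the linear part is overdamped,
with roots `l₁ l₂ = a` and `l₂` of order `1/ε`. Its inverse `greenOp` on bounded continuous
functions of time has norm at most `1/a`, so `y ↦ greenOp (F - G ∘ y)` contracts by `1/2` whatever
`ε` is. Working with functions of time rather than Fourier series avoids small divisors, so no
Diophantine condition is needed. Nonresonance enters once: the finite sum `F` then has a bounded
antiderivative, which makes `greenOp F` of order `ε` (`norm_greenOp_le_of_hasDerivAt`).

To obtain a function on the torus, the forcing is started at an arbitrary phase `ψ`, giving a fixed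
point `X ψ`, and `u ψ = X ψ 0`. Uniqueness of the fixed point yields periodicity and covariance
under the flow `ψ ↦ ψ + s ω`; the analytic inverse function theorem in the Banach space yields
analyticity (`analyticAt_of_add_contraction_eq`, `exists_response`).

Attraction comes from a quadratic Lyapunov function with a trapping argument (`lyap_le_exp`,
`isAttractedSet_ball`). Uniqueness follows from attraction: quasi-periodic functions that approach
each other coincide, by recurrence on a product torus (`eq_of_tendsto_sub_of_torusPeriodic`). -/

/-! ### The overdamped linear oscillator on bounded functions -/

theorem integrableOn_exp_mul_bounded {l : ℝ} (hl : 0 < l) (h : ℝ →ᵇ ℝ) (t : ℝ) :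
    IntegrableOn (fun s => Real.exp (l * s) * h s) (Set.Iic t) := by
  refine Integrable.mul_bdd (c := ‖h‖) (integrableOn_exp_mul_Iic hl t)
    h.continuous.aestronglyMeasurable ?_
  exact Eventually.of_forall fun s => h.norm_coe_le_norm s

/-- The bounded solution `t ↦ ∫_{-∞}^t e^{-l(t-s)} h(s) ds` of `y' + l y = h`. -/
def relaxFun (l : ℝ) (h : ℝ →ᵇ ℝ) (t : ℝ) : ℝ :=
  Real.exp (-(l * t)) * ∫ s in Set.Iic t, Real.exp (l * s) * h s

theorem hasDerivAt_relaxFun {l : ℝ} (hl : 0 < l) (h : ℝ →ᵇ ℝ) (t : ℝ) :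
    HasDerivAt (relaxFun l h) (h t - l * relaxFun l h t) t := by
  have hc : Continuous fun s => Real.exp (l * s) * h s := by fun_prop
  have hI : HasDerivAt (fun t => ∫ s in Set.Iic t, Real.exp (l * s) * h s)
      (Real.exp (l * t) * h t) t := by
    have h1 : (fun t => ∫ s in Set.Iic t, Real.exp (l * s) * h s) =
        fun t => (∫ s in Set.Iic 0, Real.exp (l * s) * h s) +
          ∫ s in (0 : ℝ)..t, Real.exp (l * s) * h s := by
      funext t
      rw [← intervalIntegral.integral_Iic_sub_Iic (integrableOn_exp_mul_bounded hl h 0)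
        (integrableOn_exp_mul_bounded hl h t)]
      ring
    rw [h1]
    exact (intervalIntegral.integral_hasDerivAt_right (hc.intervalIntegrable _ _)
      (hc.stronglyMeasurableAtFilter _ _) hc.continuousAt).const_add _
  have hE : HasDerivAt (fun t => Real.exp (-(l * t))) (Real.exp (-(l * t)) * (-(l * 1))) t :=
    (((hasDerivAt_id t).const_mul l).neg).exp
  have := hE.mul hI
  refine this.congr_deriv ?_
  have e : Real.exp (-(l * t)) * Real.exp (l * t) = 1 := by
    rw [← Real.exp_add]; simp
  simp only [relaxFun]
  linear_combination (h t) * e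

theorem abs_relaxFun_le {l : ℝ} (hl : 0 < l) (h : ℝ →ᵇ ℝ) (t : ℝ) :
    |relaxFun l h t| ≤ l⁻¹ * ‖h‖ := by
  have h1 : ‖∫ s in Set.Iic t, Real.exp (l * s) * h s‖ ≤
      ∫ s in Set.Iic t, Real.exp (l * s) * ‖h‖ := by
    refine norm_integral_le_of_norm_le ((integrableOn_exp_mul_Iic hl t).mul_const _) ?_
    refine Eventually.of_forall fun s => ?_
    rw [norm_mul, Real.norm_eq_abs, Real.abs_exp]
    exact mul_le_mul_of_nonneg_left (h.norm_coe_le_norm s) (Real.exp_pos _).le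
  rw [integral_mul_const, integral_exp_mul_Iic hl] at h1
  rw [relaxFun, abs_mul, Real.abs_exp]
  refine (mul_le_mul_of_nonneg_left h1 (Real.exp_pos _).le).trans (le_of_eq ?_)
  have e : Real.exp (-(l * t)) * Real.exp (l * t) = 1 := by
    rw [← Real.exp_add]; simp
  field_simp
  linear_combination ‖h‖ * e

/-- `relaxFun` as a bounded operator on bounded continuous functions. -/
def relax (l : ℝ) (hl : 0 < l) : (ℝ →ᵇ ℝ) →L[ℝ] (ℝ →ᵇ ℝ) :=
  LinearMap.mkContinuous
    { toFun := fun h => BoundedContinuousFunction.ofNormedAddCommGroup (relaxFun l h)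
        (continuous_iff_continuousAt.2 fun t => (hasDerivAt_relaxFun hl h t).continuousAt)
        (l⁻¹ * ‖h‖) (abs_relaxFun_le hl h)
      map_add' := fun h k => by
        ext t
        simp only [BoundedContinuousFunction.coe_ofNormedAddCommGroup, relaxFun,
          BoundedContinuousFunction.coe_add, Pi.add_apply, mul_add]
        rw [integral_add (integrableOn_exp_mul_bounded hl h t)
          (integrableOn_exp_mul_bounded hl k t), mul_add]
      map_smul' := fun c h => by
        ext t
        simp only [BoundedContinuousFunction.coe_ofNormedAddCommGroup, relaxFun,
          BoundedContinuousFunction.coe_smul, smul_eq_mul, RingHom.id_apply, mul_left_comm _ c]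
        rw [integral_const_mul]
        ring }
    l⁻¹ fun h => (BoundedContinuousFunction.norm_le (by positivity)).2 (abs_relaxFun_le hl h)

theorem norm_relax_apply_le {l : ℝ} (hl : 0 < l) (h : ℝ →ᵇ ℝ) : ‖relax l hl h‖ ≤ l⁻¹ * ‖h‖ :=
  (BoundedContinuousFunction.norm_le (by positivity)).2 (abs_relaxFun_le hl h)

theorem hasDerivAt_relax {l : ℝ} (hl : 0 < l) (h : ℝ →ᵇ ℝ) (t : ℝ) :
    HasDerivAt (relax l hl h) (h t - l * relax l hl h t) t :=
  hasDerivAt_relaxFun hl h t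

/-- `relax l hl h` is the only bounded solution of `y' + l y = h`. -/
theorem eq_relax_of_hasDerivAt {l : ℝ} (hl : 0 < l) (h y : ℝ →ᵇ ℝ)
    (hy : ∀ t, HasDerivAt y (h t - l * y t) t) : y = relax l hl h := by
  set z : ℝ →ᵇ ℝ := y - relax l hl h with hz
  have hz' : ∀ t, HasDerivAt z (-(l * z t)) t := fun t => by
    refine ((hy t).sub (hasDerivAt_relax hl h t)).congr_deriv ?_
    simp only [hz, BoundedContinuousFunction.coe_sub, Pi.sub_apply]
    ring
  -- The difference of two bounded solutions is a multiple of `e^{-lt}`; boundedness at `-∞` forces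
  -- the multiple to vanish.
  have hd : ∀ t, HasDerivAt (fun t => Real.exp (l * t) * z t) 0 t := fun t => by
    refine ((((hasDerivAt_id t).const_mul l).exp).mul (hz' t)).congr_deriv ?_
    simp only [id]
    ring
  have hconst : ∀ s t, Real.exp (l * s) * z s = Real.exp (l * t) * z t :=
    is_const_of_deriv_eq_zero (fun t => (hd t).differentiableAt) fun t => (hd t).deriv
  have hlim : Tendsto (fun s => Real.exp (l * s) * z s) atBot (𝓝 0) := by
    have h1 : Tendsto (fun s => Real.exp (l * s)) atBot (𝓝 0) :=
      Real.tendsto_exp_atBot.comp (tendsto_id.const_mul_atBot hl)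
    exact h1.zero_mul_isBoundedUnder_le
      (isBoundedUnder_of ⟨‖z‖, fun s => z.norm_coe_le_norm s⟩)
  have hzero : ∀ t, z t = 0 := fun t => by
    have : Real.exp (l * t) * z t = 0 :=
      tendsto_nhds_unique (tendsto_const_nhds.congr fun s => hconst t s) hlim
    exact (mul_eq_zero.1 this).resolve_left (Real.exp_pos _).ne'
  have : z = 0 := by ext t; exact hzero t
  exact sub_eq_zero.1 this

/-- The translate `t ↦ h (t + s)`. -/
def shift (s : ℝ) (h : ℝ →ᵇ ℝ) : ℝ →ᵇ ℝ :=
  h.compContinuous ⟨fun t => t + s, by fun_prop⟩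

@[simp] theorem shift_apply (s : ℝ) (h : ℝ →ᵇ ℝ) (t : ℝ) : shift s h t = h (t + s) := rfl

theorem shift_relax {l : ℝ} (hl : 0 < l) (s : ℝ) (h : ℝ →ᵇ ℝ) :
    shift s (relax l hl h) = relax l hl (shift s h) := by
  refine eq_relax_of_hasDerivAt hl _ _ fun t => ?_
  exact (hasDerivAt_relax hl h (t + s)).comp_add_const t s

theorem relax_of_hasDerivAt {l : ℝ} (hl : 0 < l) (p p' : ℝ →ᵇ ℝ)
    (hp : ∀ t, HasDerivAt p (p' t) t) : relax l hl p' = p - l • relax l hl p := by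
  refine (eq_relax_of_hasDerivAt hl _ _ fun t => ?_).symm
  refine ((hp t).sub ((hasDerivAt_relax hl p t).const_mul l)).congr_deriv ?_
  simp only [BoundedContinuousFunction.coe_sub, Pi.sub_apply, BoundedContinuousFunction.coe_smul,
    smul_eq_mul]

/-- The bounded solution of `y'' + (l₁ + l₂) y' + l₁ l₂ y = h`. -/
def greenOp (l₁ l₂ : ℝ) (h₁ : 0 < l₁) (h₂ : 0 < l₂) : (ℝ →ᵇ ℝ) →L[ℝ] (ℝ →ᵇ ℝ) :=
  (relax l₁ h₁).comp (relax l₂ h₂)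

section Green

variable {l₁ l₂ : ℝ} (h₁ : 0 < l₁) (h₂ : 0 < l₂)

theorem norm_greenOp_apply_le (h : ℝ →ᵇ ℝ) :
    ‖greenOp l₁ l₂ h₁ h₂ h‖ ≤ (l₁ * l₂)⁻¹ * ‖h‖ := by
  refine (norm_relax_apply_le h₁ _).trans ?_
  rw [mul_inv, mul_assoc]
  exact mul_le_mul_of_nonneg_left (norm_relax_apply_le h₂ h) (by positivity)

theorem shift_greenOp (s : ℝ) (h : ℝ →ᵇ ℝ) :
    shift s (greenOp l₁ l₂ h₁ h₂ h) = greenOp l₁ l₂ h₁ h₂ (shift s h) := by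
  simp only [greenOp, ContinuousLinearMap.comp_apply, shift_relax]

theorem hasDerivAt_greenOp (h : ℝ →ᵇ ℝ) (t : ℝ) :
    HasDerivAt (greenOp l₁ l₂ h₁ h₂ h)
      (relax l₂ h₂ h t - l₁ * greenOp l₁ l₂ h₁ h₂ h t) t :=
  hasDerivAt_relax h₁ _ t

theorem hasDerivAt_deriv_greenOp (h : ℝ →ᵇ ℝ) (t : ℝ) :
    HasDerivAt (fun t => relax l₂ h₂ h t - l₁ * greenOp l₁ l₂ h₁ h₂ h t)
      (h t - (l₁ + l₂) * (relax l₂ h₂ h t - l₁ * greenOp l₁ l₂ h₁ h₂ h t)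
        - l₁ * l₂ * greenOp l₁ l₂ h₁ h₂ h t) t := by
  refine ((hasDerivAt_relax h₂ h t).sub ((hasDerivAt_greenOp h₁ h₂ h t).const_mul l₁)).congr_deriv ?_
  ring

/-- Integration by parts moves the derivative off the forcing: with `q = relax l₂ p`, the output is
`q - l₁ • relax l₁ q`, and the factor `l₁` absorbs the large norm `l₁⁻¹`. Only `l₂⁻¹`, of order `ε`,
remains. -/
theorem norm_greenOp_le_of_hasDerivAt (p p' : ℝ →ᵇ ℝ) (hp : ∀ t, HasDerivAt p (p' t) t) :
    ‖greenOp l₁ l₂ h₁ h₂ p'‖ ≤ 2 * l₂⁻¹ * ‖p‖ := by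
  set q := relax l₂ h₂ p with hq
  have hq' : ∀ t, HasDerivAt q (relax l₂ h₂ p' t) t := fun t => by
    rw [relax_of_hasDerivAt h₂ p p' hp]
    exact hasDerivAt_relax h₂ p t
  have h1 : greenOp l₁ l₂ h₁ h₂ p' = q - l₁ • relax l₁ h₁ q := relax_of_hasDerivAt h₁ q _ hq'
  have h2 : ‖l₁ • relax l₁ h₁ q‖ ≤ ‖q‖ := by
    rw [norm_smul, Real.norm_of_nonneg h₁.le]
    refine (mul_le_mul_of_nonneg_left (norm_relax_apply_le h₁ q) h₁.le).trans (le_of_eq ?_)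
    field_simp
  have h3 : ‖q‖ ≤ l₂⁻¹ * ‖p‖ := norm_relax_apply_le h₂ p
  rw [h1]
  calc _ ≤ ‖q‖ + ‖l₁ • relax l₁ h₁ q‖ := norm_sub_le _ _
    _ ≤ 2 * l₂⁻¹ * ‖p‖ := by linarith

end Green

/-! ### Trigonometric forcing -/

theorem integral_Icc_exp_int (n : ℤ) (hn : n ≠ 0) :
    ∫ s in Set.Icc (0 : ℝ) (2 * Real.pi), Complex.exp (Complex.I * (n * s : ℝ)) = 0 := by
  have hc : (Complex.I * n : ℂ) ≠ 0 := mul_ne_zero Complex.I_ne_zero (by exact_mod_cast hn)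
  rw [integral_Icc_eq_integral_Ioc, ← intervalIntegral.integral_of_le Real.two_pi_pos.le]
  have : (fun s : ℝ => Complex.exp (Complex.I * (n * s : ℝ))) =
      fun s : ℝ => Complex.exp (Complex.I * n * s) := by
    funext s; congr 1; push_cast; ring
  rw [this, integral_exp_mul_complex hc]
  have h1 : Complex.exp (Complex.I * n * ((2 * Real.pi : ℝ) : ℂ)) = 1 := by
    rw [Complex.exp_eq_one_iff]
    exact ⟨n, by push_cast; ring⟩
  rw [h1]
  simp

theorem integral_box_exp {d : ℕ} (ν : Fin d → ℤ) (hν : ν ≠ 0) :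
    ∫ ψ in Set.Icc (0 : Fin d → ℝ) (fun _ => 2 * Real.pi),
      Complex.exp (Complex.I * ((∑ i, (ν i : ℝ) * ψ i : ℝ) : ℂ)) = 0 := by
  obtain ⟨i, hi⟩ := Function.ne_iff.1 hν
  have hprod : ∀ ψ : Fin d → ℝ, Complex.exp (Complex.I * ((∑ i, (ν i : ℝ) * ψ i : ℝ) : ℂ)) =
      ∏ i, Complex.exp (Complex.I * ((ν i : ℝ) * ψ i : ℝ)) := fun ψ => by
    rw [← Complex.exp_sum, ← Finset.mul_sum]
    push_cast
    rfl
  simp_rw [hprod]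
  rw [← Set.pi_univ_Icc, volume_pi, Measure.restrict_pi_pi]
  rw [integral_fintype_prod_eq_prod (fun i (s : ℝ) => Complex.exp (Complex.I * ((ν i : ℝ) * s : ℝ)))]
  exact Finset.prod_eq_zero (Finset.mem_univ i) (by simpa using integral_Icc_exp_int (ν i) hi)

theorem torusMean_eq_of_exp_sum {d : ℕ} {f : (Fin d → ℝ) → ℝ} (c : (Fin d → ℤ) →₀ ℂ)
    (hc : ∀ ψ : Fin d → ℝ, (f ψ : ℂ) = ∑ ν ∈ c.support,
      c ν * Complex.exp (Complex.I * ((∑ i, (ν i : ℝ) * ψ i : ℝ) : ℂ))) :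
    (torusMean f : ℂ) = c 0 := by
  set B : Set (Fin d → ℝ) := Set.Icc (0 : Fin d → ℝ) (fun _ => 2 * Real.pi) with hB
  have hvol : (volume.real B : ℂ) ≠ 0 := by
    have : 0 < volume.real B := by
      have h := Real.volume_Icc_pi_toReal (a := (0 : Fin d → ℝ)) (b := fun _ => 2 * Real.pi)
        (fun _ => Real.two_pi_pos.le)
      rw [hB, Measure.real, h]
      exact Finset.prod_pos fun i _ => by simpa using Real.pi_pos
    exact_mod_cast this.ne'
  have hcomp : IsCompact B := isCompact_Icc
  have hint : ∫ ψ in B, (f ψ : ℂ) = volume.real B * c 0 := by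
    simp_rw [hc]
    rw [integral_finsetSum]
    · rw [Finset.sum_eq_single 0]
      · simp
      · intro ν _ hν
        rw [integral_const_mul, integral_box_exp ν hν, mul_zero]
      · intro h0
        simp [Finsupp.notMem_support_iff.1 h0]
    · intro ν _
      refine ContinuousOn.integrableOn_compact hcomp (Continuous.continuousOn ?_)
      fun_prop
  rw [torusMean, setAverage_eq, ← hB]
  rw [integral_complex_ofReal] at hint
  rw [smul_eq_mul, Complex.ofReal_mul, hint, Complex.ofReal_inv]
  field_simp

theorem IsTrigPolynomial.exists_cos_sin {d : ℕ} {f : (Fin d → ℝ) → ℝ} (hf : IsTrigPolynomial f) :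
    ∃ (s : Finset (Fin d → ℤ)) (p q : (Fin d → ℤ) → ℝ), 0 ∉ s ∧ ∀ ψ, f ψ - torusMean f =
      ∑ ν ∈ s, (p ν * Real.cos (∑ i, (ν i : ℝ) * ψ i) + q ν * Real.sin (∑ i, (ν i : ℝ) * ψ i)) := by
  obtain ⟨c, hc⟩ := hf
  refine ⟨c.support.erase 0, fun ν => (c ν).re, fun ν => -(c ν).im, by simp, fun ψ => ?_⟩
  have hm := torusMean_eq_of_exp_sum c hc
  have hterm : ∀ ν : Fin d → ℤ,
      (c ν * Complex.exp (Complex.I * ((∑ i, (ν i : ℝ) * ψ i : ℝ) : ℂ))).re =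
      (c ν).re * Real.cos (∑ i, (ν i : ℝ) * ψ i) + -(c ν).im * Real.sin (∑ i, (ν i : ℝ) * ψ i) := by
    intro ν
    rw [mul_comm Complex.I, Complex.mul_re, Complex.exp_ofReal_mul_I_re, Complex.exp_ofReal_mul_I_im]
    ring
  have h1 : (f ψ : ℂ) - torusMean f = ∑ ν ∈ c.support.erase 0,
      c ν * Complex.exp (Complex.I * ((∑ i, (ν i : ℝ) * ψ i : ℝ) : ℂ)) := by
    rw [hc ψ, hm]
    by_cases h0 : (0 : Fin d → ℤ) ∈ c.support
    · rw [← Finset.add_sum_erase _ _ h0]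
      simp
    · rw [Finset.erase_eq_of_notMem h0, Finsupp.notMem_support_iff.1 h0, sub_zero]
  have h2 := congrArg Complex.re h1
  rw [Complex.re_sum] at h2
  simp only [hterm] at h2
  rw [← h2]
  simp

/-- `t ↦ cos (s t)` as a bounded continuous function. -/
def cosBCF (s : ℝ) : ℝ →ᵇ ℝ :=
  BoundedContinuousFunction.ofNormedAddCommGroup (fun t => Real.cos (t * s)) (by fun_prop) 1
    fun t => Real.abs_cos_le_one _

/-- `t ↦ sin (s t)` as a bounded continuous function. -/
def sinBCF (s : ℝ) : ℝ →ᵇ ℝ :=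
  BoundedContinuousFunction.ofNormedAddCommGroup (fun t => Real.sin (t * s)) (by fun_prop) 1
    fun t => Real.abs_sin_le_one _

theorem abs_trig_le (p q θ : ℝ) : |p * Real.cos θ + q * Real.sin θ| ≤ |p| + |q| := by
  refine (abs_add_le _ _).trans ?_
  rw [abs_mul, abs_mul]
  have h1 := mul_le_mul_of_nonneg_left (Real.abs_cos_le_one θ) (abs_nonneg p)
  have h2 := mul_le_mul_of_nonneg_left (Real.abs_sin_le_one θ) (abs_nonneg q)
  linarith

/-- The oscillating part of the forcing along `t ↦ ψ + t ω` depends analytically on `ψ`, and has a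
bounded antiderivative. -/
theorem exists_forcing {d : ℕ} {f : (Fin d → ℝ) → ℝ} (hf : IsTrigPolynomial f)
    {ω : Fin d → ℝ} (hω : NonResonant ω) :
    ∃ (M : ℝ) (F : (Fin d → ℝ) → (ℝ →ᵇ ℝ)), 0 ≤ M ∧ AnalyticOnNhd ℝ F Set.univ ∧
      (∀ ψ t, F ψ t = f (ψ + t • ω) - torusMean f) ∧ (∀ ψ, ‖F ψ‖ ≤ M) ∧
      ∀ ψ, ∃ P : ℝ →ᵇ ℝ, ‖P‖ ≤ M ∧ ∀ t, HasDerivAt P (F ψ t) t := by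
  obtain ⟨s, p, q, h0, hs⟩ := hf.exists_cos_sin
  set D : (Fin d → ℤ) → ℝ := fun ν => ∑ i, (ν i : ℝ) * ω i with hD
  have hD0 : ∀ ν ∈ s, D ν ≠ 0 := fun ν hν => by
    have : ν ≠ 0 := fun h => h0 (h ▸ hν)
    simpa only [hD, mul_comm] using hω ν this
  set φ : (Fin d → ℤ) → (Fin d → ℝ) → ℝ := fun ν ψ => ∑ i, (ν i : ℝ) * ψ i with hφ
  have hφadd : ∀ ν ψ t, φ ν (ψ + t • ω) = φ ν ψ + t * D ν := fun ν ψ t => by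
    simp only [hφ, hD, Pi.add_apply, Pi.smul_apply, smul_eq_mul, mul_add, Finset.sum_add_distrib,
      Finset.mul_sum]
    congr 1
    exact Finset.sum_congr rfl fun i _ => by ring
  have hφa : ∀ ν, AnalyticOnNhd ℝ (φ ν) Set.univ := fun ν => by
    have : φ ν = fun ψ => (∑ i, (ν i : ℝ) • ContinuousLinearMap.proj (R := ℝ) (φ := fun _ : Fin d => ℝ) i) ψ := by
      funext ψ
      simp [hφ]
    rw [this]
    exact ContinuousLinearMap.analyticOnNhd _ _
  set F : (Fin d → ℝ) → (ℝ →ᵇ ℝ) := fun ψ => ∑ ν ∈ s,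
    ((p ν * Real.cos (φ ν ψ) + q ν * Real.sin (φ ν ψ)) • cosBCF (D ν) +
      (q ν * Real.cos (φ ν ψ) - p ν * Real.sin (φ ν ψ)) • sinBCF (D ν)) with hF
  have hFt : ∀ ψ t, F ψ t = ∑ ν ∈ s, (p ν * Real.cos (φ ν ψ + t * D ν) +
      q ν * Real.sin (φ ν ψ + t * D ν)) := fun ψ t => by
    simp only [hF, BoundedContinuousFunction.coe_sum, Finset.sum_apply,
      BoundedContinuousFunction.coe_add, Pi.add_apply, BoundedContinuousFunction.coe_smul,
      smul_eq_mul, cosBCF, sinBCF, BoundedContinuousFunction.coe_ofNormedAddCommGroup]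
    refine Finset.sum_congr rfl fun ν _ => ?_
    rw [Real.cos_add, Real.sin_add]
    ring
  set M₁ : ℝ := ∑ ν ∈ s, (|p ν| + |q ν|) with hM₁
  -- This bounds the termwise antiderivative, whose coefficients are divided by `D ν = ν·ω`;
  -- nonresonance makes each divisor nonzero, and there are finitely many.
  set M₂ : ℝ := ∑ ν ∈ s, (|-q ν / D ν| + |p ν / D ν|) with hM₂
  have hM₁0 : 0 ≤ M₁ := Finset.sum_nonneg fun ν _ => by positivity
  have hM₂0 : 0 ≤ M₂ := Finset.sum_nonneg fun ν _ => by positivity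
  refine ⟨M₁ + M₂, F, by positivity, ?_, ?_, ?_, ?_⟩
  · intro ψ _
    have hc : ∀ ν, AnalyticAt ℝ (fun ψ => Real.cos (φ ν ψ)) ψ := fun ν =>
      Real.analyticAt_cos.comp (hφa ν ψ trivial)
    have hsn : ∀ ν, AnalyticAt ℝ (fun ψ => Real.sin (φ ν ψ)) ψ := fun ν =>
      Real.analyticAt_sin.comp (hφa ν ψ trivial)
    refine Finset.analyticAt_fun_sum _ fun ν _ => ?_
    exact (((analyticAt_const.mul (hc ν)).add (analyticAt_const.mul (hsn ν))).smul
      analyticAt_const).add (((analyticAt_const.mul (hc ν)).sub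
        (analyticAt_const.mul (hsn ν))).smul analyticAt_const)
  · intro ψ t
    rw [hFt, hs]
    exact Finset.sum_congr rfl fun ν _ => by rw [← hφadd]
  · intro ψ
    refine (BoundedContinuousFunction.norm_le (by positivity)).2 fun t => ?_
    rw [hFt, Real.norm_eq_abs]
    refine (Finset.abs_sum_le_sum_abs _ _).trans ?_
    refine (Finset.sum_le_sum fun ν _ => abs_trig_le _ _ _).trans ?_
    linarith
  · intro ψ
    have hb : ∀ t : ℝ, ‖∑ ν ∈ s, (-q ν / D ν * Real.cos (φ ν ψ + t * D ν) +
        p ν / D ν * Real.sin (φ ν ψ + t * D ν))‖ ≤ M₁ + M₂ := fun t => by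
      rw [Real.norm_eq_abs]
      refine (Finset.abs_sum_le_sum_abs _ _).trans ?_
      refine (Finset.sum_le_sum fun ν _ => abs_trig_le _ _ _).trans ?_
      linarith
    refine ⟨BoundedContinuousFunction.ofNormedAddCommGroup _ (by fun_prop) (M₁ + M₂) hb,
      BoundedContinuousFunction.norm_ofNormedAddCommGroup_le _ (by positivity) hb, fun t => ?_⟩
    rw [BoundedContinuousFunction.coe_ofNormedAddCommGroup, hFt]
    refine HasDerivAt.fun_sum fun ν hν => ?_
    have hθ : HasDerivAt (fun t : ℝ => φ ν ψ + t * D ν) (1 * D ν) t :=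
      ((hasDerivAt_id t).mul_const _).const_add _
    refine ((hθ.cos.const_mul _).add (hθ.sin.const_mul _)).congr_deriv ?_
    have := hD0 ν hν
    field_simp
    ring

/-! ### Analytic dependence in Banach spaces -/

/-- Composition with a real analytic function is an analytic map on a ball of bounded continuous
functions. -/
theorem exists_analytic_superposition {g : ℝ → ℝ} {c : ℝ} (hg : AnalyticAt ℝ g c) :
    ∃ r : ℝ, 0 < r ∧ ∃ N : (ℝ →ᵇ ℝ) → (ℝ →ᵇ ℝ), AnalyticOnNhd ℝ N (Metric.ball 0 r) ∧
      ∀ x ∈ Metric.ball (0 : ℝ →ᵇ ℝ) r, ∀ t, N x t = g (c + x t) := by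
  obtain ⟨p, R, hp⟩ := hg
  -- The Taylor series of `g` at `c` is read in the Banach algebra of bounded functions. The norms
  -- of its terms are unchanged, so the radius does not shrink; evaluation at `t` is a continuous
  -- algebra map and recovers the scalar series.
  set q : FormalMultilinearSeries ℝ (ℝ →ᵇ ℝ) (ℝ →ᵇ ℝ) :=
    FormalMultilinearSeries.ofScalars (ℝ →ᵇ ℝ) p.coeff with hq
  have hle : p.radius ≤ q.radius := by
    refine FormalMultilinearSeries.radius_le_of_le fun n => ?_
    rw [hq, FormalMultilinearSeries.ofScalars_norm, ← FormalMultilinearSeries.norm_apply_eq_norm_coef]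
  have hqpos : 0 < q.radius := hp.r_pos.trans_le (hp.r_le.trans hle)
  have hqs := q.hasFPowerSeriesOnBall hqpos
  obtain ⟨r, hr0, hrR⟩ := ENNReal.lt_iff_exists_nnreal_btwn.1 hp.r_pos
  have hsub : ∀ x ∈ Metric.ball (0 : ℝ →ᵇ ℝ) r, x ∈ Metric.eball (0 : ℝ →ᵇ ℝ) q.radius := by
    intro x hx
    rw [← Metric.eball_coe] at hx
    exact Metric.eball_subset_eball (hrR.le.trans (hp.r_le.trans hle)) hx
  refine ⟨r, by exact_mod_cast hr0, q.sum, hqs.analyticOnNhd.mono hsub, fun x hx t => ?_⟩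
  have h1 : HasSum (fun n => (p.coeff n • x ^ n) t) (q.sum x t) := by
    have := (q.hasSum (hsub x hx)).mapL (BoundedContinuousFunction.evalCLM ℝ t)
    simpa [hq, FormalMultilinearSeries.ofScalars_apply_eq] using this
  have hxt : x t ∈ Metric.eball (0 : ℝ) R := by
    have : x t ∈ Metric.eball (0 : ℝ) r := by
      rw [Metric.eball_coe, mem_ball_zero_iff]
      exact (x.norm_coe_le_norm t).trans_lt (mem_ball_zero_iff.1 hx)
    exact Metric.eball_subset_eball hrR.le this
  have h2 := hp.hasSum hxt
  refine h1.unique (h2.congr_fun ?_)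
  intro n
  simp [mul_comm]

open scoped ContDiff in
/-- Analytic dependence on parameters of the solution of `x + K x = A e`, `K` a contraction. -/
theorem analyticAt_of_add_contraction_eq {E X : Type*} [NormedAddCommGroup E] [NormedSpace ℝ E]
    [NormedAddCommGroup X] [NormedSpace ℝ X] [CompleteSpace X] {K : X → X}
    (hK : LipschitzWith (1 / 2) K) {A : E → X} {e₀ : E} (hA : AnalyticAt ℝ A e₀) {x : E → X}
    (hx : ∀ e, x e + K (x e) = A e) (hKa : AnalyticAt ℝ K (x e₀)) : AnalyticAt ℝ x e₀ := by
  set Φ : X → X := fun y => y + K y with hΦ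
  have hΦa : ContDiffAt ℝ ω Φ (x e₀) := (analyticAt_id.add hKa).contDiffAt
  have hn : ‖-fderiv ℝ K (x e₀)‖ < 1 := by
    rw [norm_neg]
    refine (norm_fderiv_le_of_lipschitz ℝ hK).trans_lt ?_
    norm_num
  set L : X ≃L[ℝ] X := ContinuousLinearEquiv.unitsEquiv ℝ X (Units.oneSub _ hn) with hL
  have hL' : HasFDerivAt Φ (L : X →L[ℝ] X) (x e₀) := by
    refine ((hasFDerivAt_id (x e₀)).add hKa.differentiableAt.hasFDerivAt).congr_fderiv ?_
    ext v
    simp [hL]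
  -- Continuity is needed first: the local inverse of `Φ` undoes `Φ` only near `x e₀`, so `x e` must
  -- be known to lie there.
  have hcont : ContinuousAt x e₀ := by
    have hb : ∀ e, dist (x e) (x e₀) ≤ 2 * dist (A e) (A e₀) := fun e => by
      have h1 := hK.dist_le_mul (x e) (x e₀)
      rw [dist_eq_norm, dist_eq_norm] at h1
      rw [dist_eq_norm, dist_eq_norm, ← hx e, ← hx e₀]
      have h2 : ‖x e - x e₀‖ ≤
          ‖x e + K (x e) - (x e₀ + K (x e₀))‖ + ‖K (x e) - K (x e₀)‖ := by
        refine le_trans (le_of_eq ?_) (norm_sub_le _ _)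
        congr 1
        abel
      have h3 : (((1 / 2 : NNReal)) : ℝ) = 1 / 2 := by norm_num
      rw [h3] at h1
      linarith
    rw [ContinuousAt, tendsto_iff_dist_tendsto_zero]
    refine squeeze_zero (fun _ => dist_nonneg) hb ?_
    simpa using (tendsto_iff_dist_tendsto_zero.1 hA.continuousAt.tendsto).const_mul 2
  have hinv : AnalyticAt ℝ (hΦa.localInverse hL' (by simp)) (A e₀) := by
    rw [← hx e₀]
    exact (hΦa.to_localInverse hL' (by simp)).analyticAt
  refine (hinv.comp hA).congr ?_
  have := hcont.eventually (hΦa.hasStrictFDerivAt' hL' (by simp)).eventually_left_inverse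
  filter_upwards [this] with e he
  simp only [Function.comp_apply, ← hx e]
  exact he

/-! ### Recurrence on tori -/

/-- The compact torus `(ℝ/2πℤ)^n`. -/
abbrev Torus (n : ℕ) : Type := Fin n → AddCircle (2 * Real.pi)

/-- The projection `ℝ^n → (ℝ/2πℤ)^n`. -/
def toTorus {n : ℕ} : (Fin n → ℝ) → Torus n := Pi.map fun _ x => (x : AddCircle (2 * Real.pi))

theorem toTorus_add {n : ℕ} (x y : Fin n → ℝ) : toTorus (x + y) = toTorus x + toTorus y := rfl

theorem toTorus_nsmul {n : ℕ} (k : ℕ) (x : Fin n → ℝ) :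
    toTorus ((k : ℝ) • x) = k • toTorus x := by
  ext i
  simp [toTorus, Pi.map, ← nsmul_eq_mul]

theorem exists_lift_torus {n : ℕ} {h : (Fin n → ℝ) → ℝ} (hc : Continuous h)
    (hp : TorusPeriodic h) : ∃ H : Torus n → ℝ, Continuous H ∧ ∀ x, H (toTorus x) = h x := by
  have hq : IsOpenQuotientMap (toTorus (n := n)) :=
    IsOpenQuotientMap.piMap fun _ => QuotientAddGroup.isOpenQuotientMap_mk
  have hfac : ∀ x y, toTorus x = toTorus y → h x = h y := by
    intro x y hxy
    have : ∀ i, ∃ k : ℤ, x i = y i + 2 * Real.pi * k := fun i => by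
      have hi : (x i : AddCircle (2 * Real.pi)) = (y i : AddCircle (2 * Real.pi)) := congrFun hxy i
      obtain ⟨k, hk⟩ := AddSubgroup.mem_zmultiples_iff.1 (QuotientAddGroup.eq_iff_sub_mem.1 hi)
      exact ⟨k, by rw [zsmul_eq_mul] at hk; linarith⟩
    choose k hk using this
    rw [← hp y k]
    exact congrArg h (funext hk)
  have hlift : ∀ x, h (Function.surjInv hq.surjective (toTorus x)) = h x := fun x =>
    hfac _ _ (Function.surjInv_eq hq.surjective (toTorus x))
  refine ⟨fun y => h (Function.surjInv hq.surjective y), ?_, hlift⟩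
  rw [hq.isQuotientMap.continuous_iff]
  exact hc.congr fun x => (hlift x).symm

/-- In the compact group `Torus n × Torus m` the multiples of any point cluster at `0`. Hence along
some integers `j → ∞` the values at time `t + j` return to those at time `t`, while their difference
tends to `0`. The two frequency vectors need not be related. -/
theorem eq_of_tendsto_sub_of_torusPeriodic {n m : ℕ} {h : (Fin n → ℝ) → ℝ} {k : (Fin m → ℝ) → ℝ}
    (hc : Continuous h) (hp : TorusPeriodic h) (kc : Continuous k) (kp : TorusPeriodic k)
    (a : Fin n → ℝ) (b : Fin m → ℝ)
    (hlim : Tendsto (fun t : ℝ => h (t • a) - k (t • b)) atTop (𝓝 0)) (t : ℝ) :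
    h (t • a) = k (t • b) := by
  have : Fact (0 < 2 * Real.pi) := ⟨Real.two_pi_pos⟩
  obtain ⟨H, Hc, hH⟩ := exists_lift_torus hc hp
  obtain ⟨K, Kc, hK⟩ := exists_lift_torus kc kp
  have hcl : MapClusterPt (0 : Torus n × Torus m) atTop
      (fun j : ℕ => j • (toTorus a, toTorus b)) := mapClusterPt_zero_atTop_nsmul _
  have hcont : Continuous fun p : Torus n × Torus m =>
      H (toTorus (t • a) + p.1) - K (toTorus (t • b) + p.2) := by fun_prop
  have h1 := hcl.continuousAt_comp (hcont.continuousAt (x := 0))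
  have h2 : Tendsto (fun j : ℕ => h ((t + j) • a) - k ((t + j) • b)) atTop (𝓝 0) :=
    hlim.comp (tendsto_atTop_add_const_left _ t tendsto_natCast_atTop_atTop)
  have h3 : (fun p : Torus n × Torus m => H (toTorus (t • a) + p.1) - K (toTorus (t • b) + p.2)) ∘
      (fun j : ℕ => j • (toTorus a, toTorus b)) =
      fun j : ℕ => h ((t + j) • a) - k ((t + j) • b) := by
    funext j
    simp only [Function.comp, Prod.smul_mk, ← toTorus_nsmul, ← toTorus_add, hH, hK, add_smul]
  rw [h3] at h1
  obtain ⟨φ, hφ, hφlim⟩ := h1.tendsto_subseq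
  have h4 := tendsto_nhds_unique hφlim (h2.comp hφ.tendsto_atTop)
  simp only [Prod.fst_zero, Prod.snd_zero, add_zero, hH, hK] at h4
  exact sub_eq_zero.1 h4

/-! ### Lyapunov estimates and trapping -/

/-- A Lyapunov function of the damped oscillator `y'' + κ y' + a y = 0`, with `z = y'`. -/
def lyap (κ a y z : ℝ) : ℝ := z ^ 2 + κ * y * z + (κ ^ 2 / 2 + a) * y ^ 2

theorem sq_pos_le_lyap {κ a : ℝ} (ha : 0 < a) (y z : ℝ) : κ ^ 2 / 4 * y ^ 2 ≤ lyap κ a y z := by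
  have : lyap κ a y z = (z + κ * y / 2) ^ 2 + (κ ^ 2 / 4 + a) * y ^ 2 := by rw [lyap]; ring
  rw [this]
  nlinarith [sq_nonneg (z + κ * y / 2), mul_nonneg ha.le (sq_nonneg y)]

theorem sq_vel_le_lyap {κ a : ℝ} (ha : 0 < a) (y z : ℝ) : z ^ 2 / 2 ≤ lyap κ a y z := by
  have : lyap κ a y z = z ^ 2 / 2 + (z + κ * y) ^ 2 / 2 + a * y ^ 2 := by rw [lyap]; ring
  rw [this]
  nlinarith [sq_nonneg (z + κ * y), mul_nonneg ha.le (sq_nonneg y)]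

theorem lyap_le {κ a : ℝ} (y z : ℝ) : lyap κ a y z ≤ 3 / 2 * z ^ 2 + (κ ^ 2 + a) * y ^ 2 := by
  rw [lyap]
  nlinarith [sq_nonneg (z - κ * y)]

/-- The coefficient `κ²/2 + a` in `lyap` cancels every `y z` term, leaving `-κ z² - κ a y² + 2 r z +
κ r y` with `r` the perturbation. The bound on `r` lets the negative squares win. -/
theorem lyap_deriv_le {κ a : ℝ} (ha : 0 < a) (hκ : 0 < κ) (haκ : 4 * a ≤ κ ^ 2) {y z w : ℝ}
    (hw : |w + κ * z + a * y| ≤ a / 2 * |y|) :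
    2 * z * w + (κ * z * z + κ * y * w) + (κ ^ 2 / 2 + a) * (2 * y * z) ≤
      -(a / (4 * κ)) * lyap κ a y z := by
  set r := w + κ * z + a * y with hr
  have hw' : w = r - κ * z - a * y := by rw [hr]; ring
  have h1 : r ^ 2 ≤ a ^ 2 / 4 * y ^ 2 := by
    have := pow_le_pow_left₀ (abs_nonneg r) hw 2
    rw [sq_abs, mul_pow, sq_abs] at this
    linarith
  have h2 : r * y ≤ a / 2 * y ^ 2 := by
    calc r * y ≤ |r| * |y| := by rw [← abs_mul]; exact le_abs_self _
      _ ≤ a / 2 * |y| * |y| := mul_le_mul_of_nonneg_right hw (abs_nonneg y)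
      _ = a / 2 * y ^ 2 := by rw [mul_assoc, abs_mul_abs_self]; ring
  have hV := lyap_le (κ := κ) (a := a) y z
  have key : 4 * κ * (2 * z * w + (κ * z * z + κ * y * w) + (κ ^ 2 / 2 + a) * (2 * y * z)) ≤
      -a * lyap κ a y z := by
    have e : 4 * κ * (2 * z * w + (κ * z * z + κ * y * w) + (κ ^ 2 / 2 + a) * (2 * y * z)) =
        -4 * κ ^ 2 * z ^ 2 - 4 * κ ^ 2 * a * y ^ 2 + 8 * κ * (r * z) + 4 * κ ^ 2 * (r * y) := by
      rw [hw']; ring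
    rw [e]
    have h3 : 8 * κ * (r * z) ≤ 2 * κ ^ 2 * z ^ 2 + 8 * r ^ 2 := by
      nlinarith [sq_nonneg (κ * z - 2 * r)]
    have h4 : 4 * κ ^ 2 * (r * y) ≤ 4 * κ ^ 2 * (a / 2 * y ^ 2) :=
      mul_le_mul_of_nonneg_left h2 (by positivity)
    have h5 : a * lyap κ a y z ≤ a * (3 / 2 * z ^ 2 + (κ ^ 2 + a) * y ^ 2) :=
      mul_le_mul_of_nonneg_left hV ha.le
    have h6 : 4 * a * z ^ 2 ≤ κ ^ 2 * z ^ 2 := mul_le_mul_of_nonneg_right haκ (sq_nonneg z)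
    have h7 : 4 * a * (a * y ^ 2) ≤ κ ^ 2 * (a * y ^ 2) :=
      mul_le_mul_of_nonneg_right haκ (by positivity)
    have h8 : 0 ≤ κ ^ 2 * (a * y ^ 2) := by positivity
    have h9 : 0 ≤ κ ^ 2 * z ^ 2 := by positivity
    nlinarith
  rw [neg_mul, div_mul_eq_mul_div, ← neg_div, le_div_iff₀ (by positivity)]
  linarith

/-- Trapping: if the dynamics is that of the perturbed damped oscillator inside the sublevel set
`lyap ≤ R`, then a trajectory starting there stays there, and decays exponentially. -/
theorem lyap_le_exp {κ a R : ℝ} (ha : 0 < a) (hκ : 0 < κ) (haκ : 4 * a ≤ κ ^ 2) (hR : 0 < R)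
    {y z y' z' : ℝ → ℝ} {t₀ : ℝ}
    (hy : ∀ t, t₀ ≤ t → HasDerivWithinAt y (y' t) (Set.Ici t₀) t)
    (hz : ∀ t, t₀ ≤ t → HasDerivWithinAt z (z' t) (Set.Ici t₀) t)
    (hdyn : ∀ t, t₀ ≤ t → lyap κ a (y t) (z t) ≤ R →
      y' t = z t ∧ |z' t + κ * z t + a * y t| ≤ a / 2 * |y t|)
    (h0 : lyap κ a (y t₀) (z t₀) ≤ R) {t : ℝ} (ht : t₀ ≤ t) :
    lyap κ a (y t) (z t) ≤ R * Real.exp (-(a / (8 * κ)) * (t - t₀)) := by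
  -- Half the rate in `lyap_deriv_le`, so that at a contact with the barrier the derivative is
  -- strictly below the barrier's. The barrier never exceeds `R`, so `hdyn` is available at each
  -- contact.
  set c := a / (8 * κ) with hc
  have hc0 : 0 < c := by positivity
  have hV : ∀ s, t₀ ≤ s → HasDerivWithinAt (fun s => lyap κ a (y s) (z s))
      (2 * z s * z' s + (κ * y' s * z s + κ * y s * z' s) +
        (κ ^ 2 / 2 + a) * (2 * y s * y' s)) (Set.Ici t₀) s := fun s hs => by
    have := (((hz s hs).pow 2).add (((hy s hs).const_mul κ).mul (hz s hs))).add
      (((hy s hs).pow 2).const_mul (κ ^ 2 / 2 + a))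
    refine this.congr_deriv ?_
    simp
  have hB : ∀ s, HasDerivAt (fun s => R * Real.exp (-c * (s - t₀)))
      (R * (Real.exp (-c * (s - t₀)) * (-c * 1))) s := fun s =>
    ((((hasDerivAt_id s).sub_const t₀).const_mul (-c)).exp).const_mul R
  refine image_le_of_deriv_right_lt_deriv_boundary' (a := t₀) (b := t)
    (f := fun s => lyap κ a (y s) (z s)) (B := fun s => R * Real.exp (-c * (s - t₀)))
    (fun s hs => ((hV s hs.1).continuousWithinAt).mono Set.Icc_subset_Ici_self)
    (fun s hs => (hV s hs.1).mono (Set.Ici_subset_Ici.2 hs.1)) (by simpa using h0)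
    (fun s _ => (hB s).continuousAt.continuousWithinAt)
    (fun s _ => (hB s).hasDerivWithinAt) ?_ (Set.right_mem_Icc.2 ht)
  intro s hs hEq
  have hexp : Real.exp (-c * (s - t₀)) ≤ 1 := by
    rw [Real.exp_le_one_iff]
    nlinarith [hs.1]
  have hpos : 0 < R * Real.exp (-c * (s - t₀)) := by positivity
  obtain ⟨h1, h2⟩ := hdyn s hs.1 (by rw [hEq]; nlinarith)
  have h3 := lyap_deriv_le ha hκ haκ h2
  rw [hEq, show a / (4 * κ) = 2 * c by rw [hc]; field_simp; norm_num] at h3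
  rw [h1]
  nlinarith [mul_pos hc0 hpos]

/-! ### Global solutions and cut-offs -/

/-- Global solutions for a bounded, uniformly Lipschitz time-dependent vector field. -/
theorem exists_global_solution {E : Type*} [NormedAddCommGroup E] [NormedSpace ℝ E]
    [CompleteSpace E] {v : ℝ → E → E} {K L : ℝ≥0} (hK : ∀ t, LipschitzWith K (v t))
    (hc : ∀ p, Continuous fun t => v t p) (hL : ∀ t p, ‖v t p‖ ≤ L) (t₀ : ℝ) (p₀ : E) :
    ∃ α : ℝ → E, α t₀ = p₀ ∧ ∀ t, HasDerivAt α (v t (α t)) t := by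
  have hloc : ∀ n : ℕ, ∃ α : ℝ → E, α t₀ = p₀ ∧
      ∀ t ∈ Set.Ioo (t₀ - (n + 1)) (t₀ + (n + 1)), HasDerivAt α (v t (α t)) t := by
    intro n
    have hn : (0 : ℝ) < n + 1 := by positivity
    -- The radius `L * (n + 1)` is the farthest a trajectory of speed at most `L` can go in this
    -- time, so the interval can be arbitrarily long.
    have hPL : IsPicardLindelof v (tmin := t₀ - (n + 1)) (tmax := t₀ + (n + 1))
        ⟨t₀, by constructor <;> linarith⟩ p₀ (L * (n + 1)) 0 L K :=
      { lipschitzOnWith := fun t _ => (hK t).lipschitzOnWith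
        continuousOn := fun p _ => (hc p).continuousOn
        norm_le := fun t _ p _ => hL t p
        mul_max_le := by simp }
    obtain ⟨α, h0, hα⟩ := hPL.exists_eq_forall_mem_Icc_hasDerivWithinAt₀
    exact ⟨α, h0, fun t ht => (hα t (Set.Ioo_subset_Icc_self ht)).hasDerivAt
      (Icc_mem_nhds ht.1 ht.2)⟩
  choose α h0 hα using hloc
  have hmono : ∀ n m : ℕ, n ≤ m →
      Set.EqOn (α n) (α m) (Set.Ioo (t₀ - (n + 1)) (t₀ + (n + 1))) := fun n m hnm => by
    have hnm' : (n : ℝ) ≤ m := by exact_mod_cast hnm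
    have hn : (0 : ℝ) < n + 1 := by positivity
    refine ODE_solution_unique_of_mem_Ioo (v := v) (s := fun _ => Set.univ) (K := K) (t₀ := t₀)
      (fun t _ => (hK t).lipschitzOnWith) ⟨by linarith, by linarith⟩
      (fun t ht => ⟨hα n t ht, trivial⟩)
      (fun t ht => ⟨hα m t ⟨by linarith [ht.1], by linarith [ht.2]⟩, trivial⟩) ?_
    rw [h0, h0]
  have hmem : ∀ t : ℝ, ∀ n : ℕ, |t - t₀| < n + 1 ↔
      t ∈ Set.Ioo (t₀ - (n + 1)) (t₀ + (n + 1)) := fun t n => by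
    rw [abs_lt, Set.mem_Ioo]
    constructor <;> rintro ⟨h1, h2⟩ <;> constructor <;> linarith
  set β : ℝ → E := fun t => α ⌈|t - t₀|⌉₊ t with hβ
  have hself : ∀ t : ℝ, t ∈ Set.Ioo (t₀ - ((⌈|t - t₀|⌉₊ : ℕ) + 1 : ℝ)) (t₀ + (⌈|t - t₀|⌉₊ + 1)) :=
    fun t => (hmem t _).1 (by linarith [Nat.le_ceil |t - t₀|])
  have hβeq : ∀ n : ℕ, ∀ t ∈ Set.Ioo (t₀ - (n + 1 : ℝ)) (t₀ + (n + 1)), β t = α n t :=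
    fun n t ht => by
      rcases le_total n ⌈|t - t₀|⌉₊ with h | h
      · exact (hmono _ _ h ht).symm
      · exact hmono _ _ h (hself t)
  refine ⟨β, by simp [hβ, h0], fun t => ?_⟩
  rw [hβeq _ t (hself t)]
  refine (hα _ t (hself t)).congr_of_eventuallyEq ?_
  filter_upwards [Ioo_mem_nhds (hself t).1 (hself t).2] with s hs
  exact hβeq _ s hs

/-- The retraction of `ℝ` onto `[-r, r]`. -/
def clamp (r y : ℝ) : ℝ := max (-r) (min r y)

theorem lipschitzWith_clamp (r : ℝ) : LipschitzWith 1 (clamp r) :=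
  (LipschitzWith.id.const_min r).const_max (-r)

theorem abs_clamp_le {r : ℝ} (hr : 0 ≤ r) (y : ℝ) : |clamp r y| ≤ r :=
  abs_le.2 ⟨le_max_left _ _, max_le (by linarith) (min_le_left _ _)⟩

theorem clamp_of_abs_le {r y : ℝ} (hy : |y| ≤ r) : clamp r y = y := by
  rw [clamp, min_eq_right (abs_le.1 hy).2, max_eq_right (abs_le.1 hy).1]

theorem IsSolutionOn.hasDerivWithinAt {d : ℕ} {ε : ℝ} (hε : 0 < ε) {g : ℝ → ℝ}
    {f : (Fin d → ℝ) → ℝ} {ω : Fin d → ℝ} {J : Set ℝ} {x v : ℝ → ℝ}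
    (h : IsSolutionOn ε g f ω J x v) {t : ℝ} (ht : t ∈ J) :
    HasDerivWithinAt v (-(ε⁻¹ * v t) - g (x t) + f (t • ω)) J t := by
  obtain ⟨-, w, hw, he⟩ := h t ht
  refine hw.congr_deriv ?_
  field_simp
  linarith

theorem isSolutionOn_of_hasDerivWithinAt {d : ℕ} {ε : ℝ} (hε : 0 < ε) {g : ℝ → ℝ}
    {f : (Fin d → ℝ) → ℝ} {ω : Fin d → ℝ} {J : Set ℝ} {x v : ℝ → ℝ}
    (hx : ∀ t ∈ J, HasDerivWithinAt x (v t) J t)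
    (hv : ∀ t ∈ J, HasDerivWithinAt v (-(ε⁻¹ * v t) - g (x t) + f (t • ω)) J t) :
    IsSolutionOn ε g f ω J x v := fun t ht =>
  ⟨hx t ht, _, hv t ht, by field_simp; ring⟩

/-- The level `7 r² κ²` contains all differences of size `2r` in each coordinate
(`lyap_le_of_abs_le`), while positions on it stay within `6r` and velocities within `4κr`. Adding
the reference solution, of size `r`, gives the thresholds `7r` and `5κr` used below. -/
theorem bounds_of_lyap_le {κ a r y z : ℝ} (ha : 0 < a) (hκ : 0 < κ) (hr : 0 < r)
    (h : lyap κ a y z ≤ 7 * r ^ 2 * κ ^ 2) : |y| ≤ 6 * r ∧ |z| ≤ 4 * (κ * r) := by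
  constructor
  · have h1 := (sq_pos_le_lyap (κ := κ) ha y z).trans h
    have h2 : κ ^ 2 * (y ^ 2) ≤ κ ^ 2 * ((6 * r) ^ 2) := by
      nlinarith [mul_pos (pow_pos hκ 2) (pow_pos hr 2)]
    exact abs_le_of_sq_le_sq (le_of_mul_le_mul_left h2 (by positivity)) (by positivity)
  · have h1 := (sq_vel_le_lyap (κ := κ) ha y z).trans h
    refine abs_le_of_sq_le_sq ?_ (by positivity)
    nlinarith [mul_pos (pow_pos hκ 2) (pow_pos hr 2)]

theorem lyap_le_of_abs_le {κ a r y z : ℝ} (ha : 0 < a) (hκ : 2 ≤ κ) (haκ : 4 * a ≤ κ ^ 2)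
    (hy : |y| ≤ 2 * r) (hz : |z| ≤ 2 * r) : lyap κ a y z ≤ 7 * r ^ 2 * κ ^ 2 := by
  have h1 : y ^ 2 ≤ 4 * r ^ 2 := by
    have := pow_le_pow_left₀ (abs_nonneg y) hy 2
    rw [sq_abs] at this
    linarith
  have h2 : z ^ 2 ≤ 4 * r ^ 2 := by
    have := pow_le_pow_left₀ (abs_nonneg z) hz 2
    rw [sq_abs] at this
    linarith
  have h3 : (κ ^ 2 + a) * y ^ 2 ≤ (κ ^ 2 + a) * (4 * r ^ 2) :=
    mul_le_mul_of_nonneg_left h1 (by positivity)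
  have h4 : a * r ^ 2 ≤ κ ^ 2 / 4 * r ^ 2 :=
    mul_le_mul_of_nonneg_right (by linarith) (sq_nonneg r)
  have h5 : 4 * r ^ 2 ≤ κ ^ 2 * r ^ 2 :=
    mul_le_mul_of_nonneg_right (by nlinarith) (sq_nonneg r)
  have := lyap_le (κ := κ) (a := a) y z
  nlinarith

/-! ### Attraction to a solution near the equilibrium -/

section Attraction

variable {κ a c r : ℝ} {g φ x₀ v₀ : ℝ → ℝ}

/-- Two trajectories, one of which stays near `(c, 0)` and the other starts near it, approach each
other exponentially. -/
theorem lyap_sub_le_exp (ha : 0 < a) (hκ : 2 ≤ κ) (haκ : 4 * a ≤ κ ^ 2) (hr : 0 < r)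
    (hg : ∀ y₁ y₂, |y₁ - c| ≤ 7 * r → |y₂ - c| ≤ 7 * r →
      |g y₁ - g y₂ - a * (y₁ - y₂)| ≤ a / 2 * |y₁ - y₂|)
    (hx₀ : ∀ t, HasDerivAt x₀ (v₀ t) t)
    (hv₀ : ∀ t, HasDerivAt v₀ (-(κ * v₀ t) - g (x₀ t) + φ t) t)
    (hx₀c : ∀ t, |x₀ t - c| < r) (hv₀c : ∀ t, |v₀ t| < r) {x v x' v' : ℝ → ℝ} {t₀ : ℝ}
    (hx : ∀ t, t₀ ≤ t → HasDerivWithinAt x (x' t) (Set.Ici t₀) t)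
    (hv : ∀ t, t₀ ≤ t → HasDerivWithinAt v (v' t) (Set.Ici t₀) t)
    (hdyn : ∀ t, t₀ ≤ t → |x t - c| ≤ 7 * r → |v t| ≤ 5 * (κ * r) →
      x' t = v t ∧ v' t = -(κ * v t) - g (x t) + φ t)
    (h0 : (x t₀, v t₀) ∈ Metric.ball (c, (0 : ℝ)) r) {t : ℝ} (ht : t₀ ≤ t) :
    lyap κ a (x t - x₀ t) (v t - v₀ t) ≤
      7 * r ^ 2 * κ ^ 2 * Real.exp (-(a / (8 * κ)) * (t - t₀)) := by
  have hκ0 : 0 < κ := by linarith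
  rw [Metric.mem_ball, Prod.dist_eq, max_lt_iff, Real.dist_eq, Real.dist_eq, sub_zero] at h0
  refine lyap_le_exp (y := fun t => x t - x₀ t) (z := fun t => v t - v₀ t) ha hκ0 haκ
    (by positivity) (fun s hs => (hx s hs).sub (hx₀ s).hasDerivWithinAt)
    (fun s hs => (hv s hs).sub (hv₀ s).hasDerivWithinAt) ?_ ?_ ht
  · intro s hs hle
    obtain ⟨hy, hz⟩ := bounds_of_lyap_le ha hκ0 hr hle
    have h1 : |x s - c| ≤ 7 * r := by
      have := abs_add_le (x s - x₀ s) (x₀ s - c)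
      rw [sub_add_sub_cancel] at this
      linarith [hx₀c s]
    have h2 : |v s| ≤ 5 * (κ * r) := by
      have := abs_add_le (v s - v₀ s) (v₀ s)
      rw [sub_add_cancel] at this
      nlinarith [hv₀c s]
    obtain ⟨e1, e2⟩ := hdyn s hs h1 h2
    refine ⟨by rw [e1], ?_⟩
    rw [e2, ← abs_neg]
    refine le_trans (le_of_eq ?_) (hg (x s) (x₀ s) h1 (by linarith [hx₀c s]))
    congr 1
    ring
  · refine lyap_le_of_abs_le ha hκ haκ ?_ ?_
    · have := abs_sub_le (x t₀) c (x₀ t₀)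
      rw [abs_sub_comm c] at this
      linarith [hx₀c t₀]
    · have := abs_sub (v t₀) (v₀ t₀)
      linarith [hv₀c t₀]

theorem isSimplyConnected_ball {E : Type*} [NormedAddCommGroup E] [NormedSpace ℝ E] (p : E)
    {r : ℝ} (hr : 0 < r) : IsSimplyConnected (Metric.ball p r) := by
  have : ContractibleSpace (Metric.ball p r) :=
    (convex_ball p r).contractibleSpace ⟨p, Metric.mem_ball_self hr⟩
  exact SimplyConnectedSpace.ofContractible _

theorem tendsto_zero_of_sq_le_exp {y : ℝ → ℝ} {A b t₀ : ℝ} (hb : 0 < b)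
    (h : ∀ t, t₀ ≤ t → y t ^ 2 ≤ A * Real.exp (-b * (t - t₀))) : Tendsto y atTop (𝓝 0) := by
  have h1 : Tendsto (fun t => A * Real.exp (-b * (t - t₀))) atTop (𝓝 0) := by
    have : Tendsto (fun t : ℝ => -b * (t - t₀)) atTop atBot :=
      (tendsto_atTop_add_const_right _ _ tendsto_id).const_mul_atTop_of_neg (by linarith)
    simpa using (Real.tendsto_exp_atBot.comp this).const_mul A
  have h2 : Tendsto (fun t => y t ^ 2) atTop (𝓝 0) :=
    squeeze_zero' (Eventually.of_forall fun t => sq_nonneg _)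
      ((eventually_ge_atTop t₀).mono h) h1
  have h3 := (Real.continuous_sqrt.tendsto 0).comp h2
  rw [Real.sqrt_zero] at h3
  exact (tendsto_zero_iff_abs_tendsto_zero y).2 (h3.congr fun t => Real.sqrt_sq_eq_abs _)

theorem isAttractedSet_ball {d : ℕ} {ε : ℝ} (hε : 0 < ε) {f : (Fin d → ℝ) → ℝ} {ω : Fin d → ℝ}
    (hf : Continuous fun t : ℝ => f (t • ω)) {A : ℝ} (hfA : ∀ t : ℝ, |f (t • ω)| ≤ A)
    (ha : 0 < a) (hκ : 2 ≤ ε⁻¹) (haκ : 4 * a ≤ ε⁻¹ ^ 2) (hr : 0 < r) {G : ℝ → ℝ}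
    (hG : LipschitzWith (a / 2).toNNReal G)
    (hGg : ∀ y, |y| ≤ 7 * r → G y = g (c + y) - g c - a * y)
    (hx₀ : IsSolutionOn ε g f ω Set.univ x₀ v₀)
    (hx₀c : ∀ t, |x₀ t - c| < r) (hv₀c : ∀ t, |v₀ t| < r) :
    IsAttractedSet ε g f ω x₀ v₀ (Metric.ball (c, (0 : ℝ)) r) := by
  set κ := ε⁻¹ with hκd
  have hκ0 : 0 < κ := by positivity
  have ha2 : ((a / 2).toNNReal : ℝ) = a / 2 := Real.coe_toNNReal _ (by positivity)
  have hg : ∀ y₁ y₂, |y₁ - c| ≤ 7 * r → |y₂ - c| ≤ 7 * r →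
      |g y₁ - g y₂ - a * (y₁ - y₂)| ≤ a / 2 * |y₁ - y₂| := fun y₁ y₂ h1 h2 => by
    have h := hG.dist_le_mul (y₁ - c) (y₂ - c)
    rw [hGg _ h1, hGg _ h2, Real.dist_eq, Real.dist_eq, ha2, add_sub_cancel, add_sub_cancel,
      sub_sub_sub_cancel_right] at h
    refine le_trans (le_of_eq ?_) h
    congr 1
    ring
  have hX : ∀ t, HasDerivAt x₀ (v₀ t) t := fun t =>
    hasDerivWithinAt_univ.1 (hx₀ t trivial).1
  have hV : ∀ t, HasDerivAt v₀ (-(κ * v₀ t) - g (x₀ t) + f (t • ω)) t := fun t =>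
    hasDerivWithinAt_univ.1 (hx₀.hasDerivWithinAt hε trivial)
  refine ⟨Metric.isOpen_ball, isSimplyConnected_ball _ hr, fun t => ?_, fun t₀ p hp => ?_,
    fun t₀ x v hsol h0 => ?_⟩
  · rw [Metric.mem_ball, Prod.dist_eq, max_lt_iff, Real.dist_eq, Real.dist_eq, sub_zero]
    exact ⟨hx₀c t, hv₀c t⟩
  · set R : ℝ := 5 * (κ * r) with hR
    have hR0 : 0 ≤ R := by positivity
    -- The vector field is cut off at the thresholds of the trapping region. It is then bounded and
    -- uniformly Lipschitz, hence has global solutions, and trapping (`hin`) shows that the cut-off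
    -- is inactive for `t ≥ t₀`.
    set W : ℝ → ℝ × ℝ → ℝ × ℝ := fun t p => (clamp R p.2,
      f (t • ω) - g c - κ * clamp R p.2 - a * clamp (7 * r) (p.1 - c) -
        G (clamp (7 * r) (p.1 - c))) with hW
    obtain ⟨K, hK⟩ : ∃ K : ℝ≥0, ∀ t, LipschitzWith K (W t) := by
      have l1 : LipschitzWith (1 * 1) fun p : ℝ × ℝ => clamp R p.2 :=
        (lipschitzWith_clamp R).comp LipschitzWith.prod_snd
      have l2 : LipschitzWith (1 * (1 + 0)) fun p : ℝ × ℝ => clamp (7 * r) (p.1 - c) :=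
        (lipschitzWith_clamp _).comp (LipschitzWith.prod_fst.sub (LipschitzWith.const c))
      have l3 := hG.comp l2
      have l4 := (lipschitzWith_smul κ).comp l1
      have l5 := (lipschitzWith_smul a).comp l2
      exact ⟨_, fun t => l1.prodMk ((((LipschitzWith.const (f (t • ω) - g c)).sub l4).sub l5).sub l3)⟩
    have hL : ∀ t p, ‖W t p‖ ≤ ((R + A + |g c| + κ * R + a * (7 * r) +
        (a / 2 * (7 * r) + |G 0|)).toNNReal : ℝ≥0) := fun t p => by
      have hA := (abs_nonneg _).trans (hfA t)
      rw [Real.coe_toNNReal _ (by positivity), Prod.norm_def]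
      have b1 := abs_clamp_le hR0 p.2
      have b2 := abs_clamp_le (r := 7 * r) (by positivity) (p.1 - c)
      set y := clamp (7 * r) (p.1 - c)
      set w := clamp R p.2
      have b3 : |G y| ≤ a / 2 * (7 * r) + |G 0| := by
        have h := hG.dist_le_mul y 0
        rw [Real.dist_eq, Real.dist_eq, ha2, sub_zero] at h
        have h' := abs_add_le (G y - G 0) (G 0)
        rw [sub_add_cancel] at h'
        nlinarith
      have b4 : |κ * w| ≤ κ * R := by
        rw [abs_mul, abs_of_pos hκ0]; exact mul_le_mul_of_nonneg_left b1 hκ0.le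
      have b5 : |a * y| ≤ a * (7 * r) := by
        rw [abs_mul, abs_of_pos ha]; exact mul_le_mul_of_nonneg_left b2 ha.le
      have p1 : 0 ≤ κ * R := by positivity
      have p2 : 0 ≤ a * (7 * r) := by positivity
      have p3 := abs_nonneg (g c)
      have p4 := (abs_nonneg _).trans b3
      refine max_le ?_ ?_
      · rw [Real.norm_eq_abs]
        linarith
      · rw [Real.norm_eq_abs]
        have q1 := abs_sub (f (t • ω) - g c - κ * w - a * y) (G y)
        have q2 := abs_sub (f (t • ω) - g c - κ * w) (a * y)
        have q3 := abs_sub (f (t • ω) - g c) (κ * w)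
        have q4 := abs_sub (f (t • ω)) (g c)
        linarith [hfA t]
    obtain ⟨α, hα0, hα⟩ := exists_global_solution hK (fun p => continuous_const.prodMk
      ((((hf.sub continuous_const).sub continuous_const).sub continuous_const).sub
        continuous_const)) hL t₀ p
    have hx : ∀ t, HasDerivAt (fun t => (α t).1) (W t (α t)).1 t := fun t => (hα t).fst
    have hv : ∀ t, HasDerivAt (fun t => (α t).2) (W t (α t)).2 t := fun t => (hα t).snd
    have hdyn : ∀ t, |(α t).1 - c| ≤ 7 * r → |(α t).2| ≤ 5 * (κ * r) →
        (W t (α t)).1 = (α t).2 ∧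
          (W t (α t)).2 = -(κ * (α t).2) - g (α t).1 + f (t • ω) := fun t h1 h2 => by
      simp only [hW]
      rw [clamp_of_abs_le h1, clamp_of_abs_le h2, hGg _ h1, add_sub_cancel]
      exact ⟨rfl, by ring⟩
    have hin : ∀ t, t₀ ≤ t → |(α t).1 - c| ≤ 7 * r ∧ |(α t).2| ≤ 5 * (κ * r) := fun t ht => by
      have h := lyap_sub_le_exp (φ := fun t => f (t • ω)) ha hκ haκ hr hg hX hV hx₀c hv₀c
        (fun t _ => (hx t).hasDerivWithinAt) (fun t _ => (hv t).hasDerivWithinAt)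
        (fun t _ => hdyn t) (by rw [hα0]; exact hp) ht
      have hexp : Real.exp (-(a / (8 * κ)) * (t - t₀)) ≤ 1 := by
        rw [Real.exp_le_one_iff]
        have : 0 < a / (8 * κ) := by positivity
        nlinarith
      have h' := h.trans (mul_le_of_le_one_right (by positivity) hexp)
      obtain ⟨h1, h2⟩ := bounds_of_lyap_le ha hκ0 hr h'
      constructor
      · have := abs_add_le ((α t).1 - x₀ t) (x₀ t - c)
        rw [sub_add_sub_cancel] at this
        linarith [hx₀c t]
      · have := abs_add_le ((α t).2 - v₀ t) (v₀ t)
        rw [sub_add_cancel] at this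
        nlinarith [hv₀c t]
    refine ⟨fun t => (α t).1, fun t => (α t).2, isSolutionOn_of_hasDerivWithinAt hε
      (fun t ht => ?_) (fun t ht => ?_), hα0⟩
    · obtain ⟨h1, h2⟩ := hin t ht
      exact ((hx t).congr_deriv (hdyn t h1 h2).1).hasDerivWithinAt
    · obtain ⟨h1, h2⟩ := hin t ht
      exact ((hv t).congr_deriv (hdyn t h1 h2).2).hasDerivWithinAt
  · have h : ∀ t, t₀ ≤ t → _ := fun t ht =>
      lyap_sub_le_exp (φ := fun t => f (t • ω)) ha hκ haκ hr hg hX hV hx₀c hv₀c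
        (fun t ht => (hsol t ht).1) (fun t ht => hsol.hasDerivWithinAt hε ht)
        (fun t _ _ _ => ⟨rfl, rfl⟩) h0 ht
    have hb : 0 < a / (8 * κ) := by positivity
    constructor
    · refine tendsto_zero_of_sq_le_exp (t₀ := t₀) (A := 4 * (7 * r ^ 2)) hb fun t ht => ?_
      have h1 := (sq_pos_le_lyap ha _ _).trans (h t ht)
      have h2 : κ ^ 2 * (x t - x₀ t) ^ 2 ≤
          κ ^ 2 * (4 * (7 * r ^ 2) * Real.exp (-(a / (8 * κ)) * (t - t₀))) := by linarith
      exact le_of_mul_le_mul_left h2 (by positivity)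
    · refine tendsto_zero_of_sq_le_exp (t₀ := t₀) (A := 2 * (7 * r ^ 2 * κ ^ 2)) hb fun t ht => ?_
      have h1 := (sq_vel_le_lyap ha _ _).trans (h t ht)
      linarith

end Attraction

/-! ### The response solution -/

/-- Near a point with derivative `a > 0`, the nonlinear remainder of `g` agrees with a globally
`a / 2`-Lipschitz function. -/
theorem exists_lipschitz_remainder {g : ℝ → ℝ} {c : ℝ} (hg : AnalyticAt ℝ g c)
    (ha : 0 < deriv g c) {r : ℝ} (hr : 0 < r) :
    ∃ δ, 0 < δ ∧ δ < r ∧ ∃ G : ℝ → ℝ, LipschitzWith (deriv g c / 2).toNNReal G ∧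
      ∀ y, |y| ≤ δ → G y = g (c + y) - g c - deriv g c * y := by
  set a := deriv g c
  -- Strict differentiability with derivative `0` gives any positive Lipschitz constant near `0`;
  -- `a/2` is what both the contraction and the Lyapunov estimate require.
  have hd : HasStrictDerivAt (fun y => g (c + y) - g c - a * y) 0 0 := by
    have h1 : HasStrictDerivAt g a (c + 0) := by rw [add_zero]; exact hg.hasStrictDerivAt
    have h2 : HasStrictDerivAt (fun y : ℝ => c + y) 1 0 := (hasStrictDerivAt_id 0).const_add c
    have h3 := (h1.comp (0 : ℝ) h2).sub_const (g c)
    have h4 := h3.sub ((hasStrictDerivAt_id (0 : ℝ)).const_mul a)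
    rwa [sub_self] at h4
  obtain ⟨s, hs, hlip⟩ := hd.hasStrictFDerivAt.exists_lipschitzOnWith_of_nnnorm_lt
    (a / 2).toNNReal (by
      have : 0 < (a / 2).toNNReal := Real.toNNReal_pos.2 (by positivity)
      simpa using this)
  obtain ⟨ρ, hρ, hρs⟩ := Metric.mem_nhds_iff.1 hs
  obtain ⟨G, hG, hGs⟩ := hlip.extend_real
  refine ⟨min ρ r / 2, by positivity, ?_, G, hG, fun y hy => ?_⟩
  · have := min_le_right ρ r
    linarith [lt_min hρ hr]
  · refine (hGs (hρs ?_)).symm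
    rw [mem_ball_zero_iff, Real.norm_eq_abs]
    have := min_le_left ρ r
    linarith [lt_min hρ hr]

theorem exists_damping_roots {κ a : ℝ} (ha : 0 < a) (hκ : 0 < κ) (haκ : 4 * a ≤ κ ^ 2) :
    ∃ l₁ l₂ : ℝ, 0 < l₁ ∧ 0 < l₂ ∧ l₁ + l₂ = κ ∧ l₁ * l₂ = a ∧ κ ≤ 2 * l₂ := by
  have hs := Real.sq_sqrt (show 0 ≤ κ ^ 2 - 4 * a by linarith)
  have hs0 := Real.sqrt_nonneg (κ ^ 2 - 4 * a)
  set s := Real.sqrt (κ ^ 2 - 4 * a)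
  have hlt : s < κ := by nlinarith
  exact ⟨(κ - s) / 2, (κ + s) / 2, by linarith, by linarith, by ring, by nlinarith, by linarith⟩

section Response

variable {d : ℕ} {a l₁ l₂ : ℝ} (h₁ : 0 < l₁) (h₂ : 0 < l₂) {G : ℝ → ℝ}
  (hG : LipschitzWith (a / 2).toNNReal G)

theorem lipschitzWith_greenOp_comp (ha : 0 < a) (hl : l₁ * l₂ = a) :
    LipschitzWith (1 / 2) fun x : ℝ →ᵇ ℝ =>
      greenOp l₁ l₂ h₁ h₂ (BoundedContinuousFunction.comp G hG x) := by
  refine LipschitzWith.of_dist_le_mul fun x y => ?_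
  rw [dist_eq_norm, ← map_sub]
  refine (norm_greenOp_apply_le h₁ h₂ _).trans ?_
  rw [← dist_eq_norm, hl]
  have h := (BoundedContinuousFunction.lipschitz_comp hG).dist_le_mul x y
  rw [Real.coe_toNNReal _ (by positivity)] at h
  calc _ ≤ a⁻¹ * (a / 2 * dist x y) := mul_le_mul_of_nonneg_left h (by positivity)
    _ = _ := by push_cast; field_simp

/-- The bounded response of the oscillator to a family of forcings covariant under the linear flow
`ψ ↦ ψ + s ω`. -/
theorem exists_response (ha : 0 < a) (hl : l₁ * l₂ = a) {F : (Fin d → ℝ) → (ℝ →ᵇ ℝ)}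
    (hF : AnalyticOnNhd ℝ F Set.univ) {ω : Fin d → ℝ}
    (hFs : ∀ ψ s, shift s (F ψ) = F (ψ + s • ω)) {r η : ℝ}
    {N : (ℝ →ᵇ ℝ) → (ℝ →ᵇ ℝ)} (hN : AnalyticOnNhd ℝ N (Metric.ball 0 r))
    (hNG : ∀ x ∈ Metric.ball (0 : ℝ →ᵇ ℝ) r, N x = BoundedContinuousFunction.comp G hG x)
    (hG0 : G 0 = 0) (hη : ∀ ψ, ‖greenOp l₁ l₂ h₁ h₂ (F ψ)‖ ≤ η) (hηr : 2 * η < r) :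
    ∃ X : (Fin d → ℝ) → (ℝ →ᵇ ℝ),
      (∀ ψ, X ψ = greenOp l₁ l₂ h₁ h₂ (F ψ - BoundedContinuousFunction.comp G hG (X ψ))) ∧
      (∀ ψ, ‖X ψ‖ ≤ 2 * η) ∧ AnalyticOnNhd ℝ X Set.univ ∧
      (∀ ψ ψ', F ψ = F ψ' → X ψ = X ψ') ∧ ∀ s : ℝ, X (s • ω) 0 = X 0 s := by
  set K : (ℝ →ᵇ ℝ) → (ℝ →ᵇ ℝ) := fun x =>
      greenOp l₁ l₂ h₁ h₂ (BoundedContinuousFunction.comp G hG x) with hKd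
  have hK : LipschitzWith (1 / 2) K := lipschitzWith_greenOp_comp h₁ h₂ hG ha hl
  have hK0 : K 0 = 0 := by
    have : BoundedContinuousFunction.comp G hG (0 : ℝ →ᵇ ℝ) = 0 := by
      ext t
      exact hG0
    rw [hKd]
    simp only [this, map_zero]
  have hhalf : (((1 / 2 : ℝ≥0)) : ℝ) = 1 / 2 := by norm_num
  have hcontr : ∀ ψ, ContractingWith (1 / 2) fun x => greenOp l₁ l₂ h₁ h₂ (F ψ) - K x := fun ψ =>
    ⟨by rw [← NNReal.coe_lt_coe, hhalf]; norm_num, by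
      refine LipschitzWith.of_dist_le_mul fun x y => ?_
      rw [dist_sub_left]
      exact hK.dist_le_mul x y⟩
  set X : (Fin d → ℝ) → (ℝ →ᵇ ℝ) := fun ψ => ContractingWith.fixedPoint _ (hcontr ψ) with hX
  have hfix : ∀ ψ, greenOp l₁ l₂ h₁ h₂ (F ψ) - K (X ψ) = X ψ := fun ψ =>
    (hcontr ψ).fixedPoint_isFixedPt
  have huniq : ∀ ψ x, greenOp l₁ l₂ h₁ h₂ (F ψ) - K x = x → x = X ψ := fun ψ x hx =>
    (hcontr ψ).fixedPoint_unique hx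
  have hXη : ∀ ψ, ‖X ψ‖ ≤ 2 * η := fun ψ => by
    have h1 : ‖X ψ‖ ≤ ‖greenOp l₁ l₂ h₁ h₂ (F ψ)‖ + ‖K (X ψ)‖ := by
      conv_lhs => rw [← hfix ψ]
      exact norm_sub_le _ _
    have h2 := hK.dist_le_mul (X ψ) 0
    rw [hK0, dist_zero_right, dist_zero_right, hhalf] at h2
    linarith [hη ψ]
  -- `greenOp` and composition with `G` commute with time translation, so the translate of `X ψ`
  -- solves the fixed point equation at phase `ψ + s • ω`.
  have hshift : ∀ ψ s, shift s (X ψ) = X (ψ + s • ω) := fun ψ s => by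
    refine huniq _ _ ?_
    conv_rhs => rw [← hfix ψ]
    have e1 : K (shift s (X ψ)) = shift s (K (X ψ)) := by
      simp only [hKd, shift_greenOp]
      rfl
    rw [e1, ← hFs, ← shift_greenOp]
    rfl
  refine ⟨X, fun ψ => ?_, hXη, fun ψ _ => ?_, fun ψ ψ' h => ?_, fun s => ?_⟩
  · rw [map_sub]
    exact (hfix ψ).symm
  · have hball : X ψ ∈ Metric.ball (0 : ℝ →ᵇ ℝ) r := by
      rw [mem_ball_zero_iff]
      exact (hXη ψ).trans_lt hηr
    refine analyticAt_of_add_contraction_eq hK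
      (A := fun ψ => greenOp l₁ l₂ h₁ h₂ (F ψ)) ?_ (fun ψ => ?_) ?_
    · exact (ContinuousLinearMap.analyticAt _ _).comp (hF ψ trivial)
    · rw [← eq_sub_iff_add_eq]
      exact (hfix ψ).symm
    · have : AnalyticAt ℝ (fun x => greenOp l₁ l₂ h₁ h₂ (N x)) (X ψ) :=
        (ContinuousLinearMap.analyticAt _ _).comp (hN _ hball)
      refine this.congr ?_
      filter_upwards [Metric.isOpen_ball.mem_nhds hball] with x hx
      rw [hNG x hx]
  · exact huniq _ _ (by rw [← h]; exact hfix ψ)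
  · have := hshift 0 s
    rw [zero_add] at this
    rw [← this, shift_apply, zero_add]

end Response

/-- A quasi-periodic solution that enters `U` is attracted to the reference solution, hence equals
it at all times by recurrence. -/
theorem IsAttractedSet.isUniqueQuasiPeriodicIn {d : ℕ} {ε c : ℝ} {g : ℝ → ℝ}
    {f : (Fin d → ℝ) → ℝ} {ω : Fin d → ℝ} {u : (Fin d → ℝ) → ℝ} {v₀ : ℝ → ℝ} {U : Set (ℝ × ℝ)}
    (hu : Continuous u) (hup : TorusPeriodic u)
    (h : IsAttractedSet ε g f ω (fun t => c + u (t • ω)) v₀ U) :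
    IsUniqueQuasiPeriodicIn ε g f ω (fun t => c + u (t • ω)) U := by
  rintro x v hx ⟨n, ω', k, hk, hkp, hxk⟩ ⟨t₁, ht₁⟩
  have hres : IsSolutionOn ε g f ω (Set.Ici t₁) x v := fun t _ => by
    obtain ⟨h1, w, h2, h3⟩ := hx t trivial
    exact ⟨h1.mono (Set.subset_univ _), w, h2.mono (Set.subset_univ _), h3⟩
  have hlim := (h.tendsto t₁ x v hres ht₁).1
  funext t
  rw [hxk t]
  refine eq_of_tendsto_sub_of_torusPeriodic (k := fun ψ => c + u ψ) hk hkp (by fun_prop)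
    (fun ψ m => ?_) ω' ω ?_ t
  · simp only [hup ψ m]
  · simpa only [hxk] using hlim

theorem IsTrigPolynomial.torusPeriodic {d : ℕ} {f : (Fin d → ℝ) → ℝ} (hf : IsTrigPolynomial f) :
    TorusPeriodic f := by
  obtain ⟨c, hc⟩ := hf
  intro ψ k
  rw [← Complex.ofReal_inj, hc, hc]
  refine Finset.sum_congr rfl fun ν _ => ?_
  congr 1
  rw [Complex.exp_eq_exp_iff_exists_int]
  refine ⟨∑ i, ν i * k i, ?_⟩
  push_cast
  simp only [mul_add, Finset.sum_add_distrib, Finset.mul_sum, Finset.sum_mul]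
  congr 1
  exact Finset.sum_congr rfl fun i _ => by ring

/-- For fixed `ε`, the quasi-periodic response solution, given a forcing family as in
`exists_forcing` and a Lipschitz extension `G` of the nonlinear remainder. -/
theorem exists_response_solution {d : ℕ} {ε a M δ c : ℝ} (hε : 0 < ε) (ha : 0 < a) (hM : 0 ≤ M)
    (hε1 : ε ≤ 1) (haκ : 4 * a ≤ ε⁻¹ ^ 2) (hδ : ε * (M * (8 + 24 * a)) < δ)
    {g : ℝ → ℝ} {f : (Fin d → ℝ) → ℝ} (hf : IsTrigPolynomial f) (hc : g c = torusMean f)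
    {ω : Fin d → ℝ} {F : (Fin d → ℝ) → (ℝ →ᵇ ℝ)} (hF : AnalyticOnNhd ℝ F Set.univ)
    (hFf : ∀ ψ t, F ψ t = f (ψ + t • ω) - torusMean f) (hFM : ∀ ψ, ‖F ψ‖ ≤ M)
    (hFP : ∀ ψ, ∃ P : ℝ →ᵇ ℝ, ‖P‖ ≤ M ∧ ∀ t, HasDerivAt P (F ψ t) t)
    {G : ℝ → ℝ} (hG : LipschitzWith (a / 2).toNNReal G)
    (hGg : ∀ y, |y| ≤ δ → G y = g (c + y) - g c - a * y)
    {N : (ℝ →ᵇ ℝ) → (ℝ →ᵇ ℝ)} (hN : AnalyticOnNhd ℝ N (Metric.ball 0 δ))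
    (hNg : ∀ x ∈ Metric.ball (0 : ℝ →ᵇ ℝ) δ, ∀ t, N x t = g (c + x t)) :
    ∃ u : (Fin d → ℝ) → ℝ, AnalyticOnNhd ℝ u Set.univ ∧ TorusPeriodic u ∧
      (∀ ψ, |u ψ| ≤ 8 * M * ε) ∧ ∃ v₀ : ℝ → ℝ,
        IsSolutionOn ε g f ω Set.univ (fun t => c + u (t • ω)) v₀ ∧
        ∀ t, |v₀ t| ≤ ε * (M * (8 + 24 * a)) := by
  set κ := ε⁻¹ with hκd
  have hκ : 0 < κ := by positivity
  obtain ⟨l₁, l₂, h₁, h₂, hsum, hprod, hl₂⟩ := exists_damping_roots ha hκ haκ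
  have hinv : l₂⁻¹ ≤ 2 * ε := by
    rw [inv_le_comm₀ h₂ (by positivity), mul_inv]
    linarith
  have hG0 : G 0 = 0 := by
    have hδ0 : 0 ≤ ε * (M * (8 + 24 * a)) := by positivity
    rw [hGg 0 (by simp; linarith)]
    simp
  set N' : (ℝ →ᵇ ℝ) → (ℝ →ᵇ ℝ) := fun x =>
    N x - BoundedContinuousFunction.const ℝ (g c) - a • x with hN'd
  have hN' : AnalyticOnNhd ℝ N' (Metric.ball 0 δ) := fun x hx =>
    ((hN x hx).sub analyticAt_const).sub ((a • ContinuousLinearMap.id ℝ (ℝ →ᵇ ℝ)).analyticAt x)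
  have hN'G : ∀ x ∈ Metric.ball (0 : ℝ →ᵇ ℝ) δ, N' x = BoundedContinuousFunction.comp G hG x := by
    intro x hx
    ext t
    have hxt : |x t| ≤ δ := (x.norm_coe_le_norm t).trans (mem_ball_zero_iff.1 hx).le
    change N x t - g c - a * x t = G (x t)
    rw [hNg x hx, hGg _ hxt]
  have hFs : ∀ ψ s, shift s (F ψ) = F (ψ + s • ω) := fun ψ s => by
    ext t
    rw [shift_apply, hFf, hFf, add_smul, add_comm (t • ω), ← add_assoc]
  have hη : ∀ ψ, ‖greenOp l₁ l₂ h₁ h₂ (F ψ)‖ ≤ 4 * ε * M := fun ψ => by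
    obtain ⟨P, hPM, hP⟩ := hFP ψ
    refine (norm_greenOp_le_of_hasDerivAt h₁ h₂ P (F ψ) hP).trans ?_
    calc 2 * l₂⁻¹ * ‖P‖ ≤ 2 * (2 * ε) * M := by gcongr
      _ = 4 * ε * M := by ring
  have hηδ : 2 * (4 * ε * M) < δ := by
    have : 0 ≤ ε * (M * (24 * a)) := by positivity
    linarith
  obtain ⟨X, hX, hXη, hXa, hXF, hX0⟩ :=
    exists_response h₁ h₂ hG ha hprod hF hFs hN' hN'G hG0 hη hηδ
  set h : ℝ →ᵇ ℝ := F 0 - BoundedContinuousFunction.comp G hG (X 0) with hh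
  have hXt : ∀ t, |X 0 t| ≤ δ := fun t =>
    ((X 0).norm_coe_le_norm t).trans ((hXη 0).trans hηδ.le)
  have hht : ∀ t, h t = f (t • ω) - g (c + X 0 t) + a * X 0 t := fun t => by
    change F 0 t - G (X 0 t) = _
    rw [hFf, hGg _ (hXt t), hc, zero_add]
    ring
  set v₀ : ℝ → ℝ := fun t => relax l₂ h₂ h t - l₁ * X 0 t with hv₀
  have hx' : ∀ t, HasDerivAt (X 0) (v₀ t) t := fun t => by
    have := hasDerivAt_greenOp h₁ h₂ h t
    rwa [hh, ← hX 0] at this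
  have hv' : ∀ t, HasDerivAt v₀ (h t - κ * v₀ t - a * X 0 t) t := fun t => by
    have := hasDerivAt_deriv_greenOp h₁ h₂ h t
    rw [hsum, hprod] at this
    have e : greenOp l₁ l₂ h₁ h₂ h = X 0 := (hX 0).symm
    rwa [e] at this
  have hsol : (fun t : ℝ => c + X (t • ω) 0) = fun t => c + X 0 t := by
    funext t
    rw [hX0]
  refine ⟨fun ψ => X ψ 0, fun ψ _ => ?_, fun ψ k => ?_, fun ψ => ?_, v₀, ?_, fun t => ?_⟩
  · exact ((BoundedContinuousFunction.evalCLM ℝ (0 : ℝ)).analyticAt _).comp (hXa ψ trivial)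
  · have : F (fun i => ψ i + 2 * Real.pi * (k i : ℝ)) = F ψ := by
      ext t
      rw [hFf, hFf, ← hf.torusPeriodic (ψ + t • ω) k]
      congr 2
      funext i
      simp only [Pi.add_apply]
      ring
    simp only [hXF _ _ this]
  · refine ((X ψ).norm_coe_le_norm 0).trans ((hXη ψ).trans (le_of_eq ?_))
    ring
  · simp only [hsol]
    refine isSolutionOn_of_hasDerivWithinAt hε
      (fun t _ => ((hx' t).const_add c).hasDerivWithinAt) (fun t _ => ?_)
    refine ((hv' t).congr_deriv ?_).hasDerivWithinAt
    rw [hht]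
    ring
  · have hx : ‖X 0‖ ≤ 8 * ε * M := (hXη 0).trans (le_of_eq (by ring))
    have hcomp : ‖BoundedContinuousFunction.comp G hG (X 0)‖ ≤ a / 2 * ‖X 0‖ := by
      refine (BoundedContinuousFunction.norm_le (by positivity)).2 fun t => ?_
      have := hG.dist_le_mul (X 0 t) 0
      rw [hG0, dist_zero_right, dist_zero_right, Real.coe_toNNReal _ (by positivity)] at this
      exact this.trans (mul_le_mul_of_nonneg_left ((X 0).norm_coe_le_norm t) (by positivity))
    have hhn : ‖h‖ ≤ M + a / 2 * ‖X 0‖ :=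
      (norm_sub_le _ _).trans (add_le_add (hFM 0) hcomp)
    -- The velocity is `relax l₂ h - l₁ X`; both terms are of order `ε`, since `l₂⁻¹ ≤ 2ε` and `l₁ =
    -- a l₂⁻¹`.
    have hl₁ : l₁ ≤ 2 * ε * a := by
      have : l₁ = l₂⁻¹ * a := by rw [← hprod]; field_simp
      rw [this]
      gcongr
    have hε2 : ε * ‖X 0‖ ≤ ε * (8 * M) := by
      refine mul_le_mul_of_nonneg_left (hx.trans ?_) hε.le
      nlinarith
    have hr : |relax l₂ h₂ h t| ≤ 2 * ε * (M + a / 2 * ‖X 0‖) :=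
      ((relax l₂ h₂ h).norm_coe_le_norm t).trans ((norm_relax_apply_le h₂ h).trans (by gcongr))
    have hl : |l₁ * X 0 t| ≤ 2 * ε * a * ‖X 0‖ := by
      rw [abs_mul, abs_of_pos h₁]
      have := (X 0).norm_coe_le_norm t
      rw [Real.norm_eq_abs] at this
      gcongr
    calc |v₀ t| ≤ |relax l₂ h₂ h t| + |l₁ * X 0 t| := abs_sub _ _
      _ ≤ 2 * ε * (M + a / 2 * ‖X 0‖) + 2 * ε * a * ‖X 0‖ := add_le_add hr hl
      _ = 2 * ε * M + 3 * a * (ε * ‖X 0‖) := by ring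
      _ ≤ 2 * ε * M + 3 * a * (ε * (8 * M)) := by gcongr
      _ ≤ ε * (M * (8 + 24 * a)) := by nlinarith [mul_nonneg hε.le hM]

end DampedForced

end

/-! ### Choice of the constants -/

theorem theorem3 {d : ℕ} (g : ℝ → ℝ) (hg : AnalyticOnNhd ℝ g Set.univ)
    (f : (Fin d → ℝ) → ℝ) (hf : DampedForced.IsTrigPolynomial f)
    (c₀ : ℝ) (hc₀ : g c₀ = DampedForced.torusMean f) (ha : 0 < deriv g c₀)
    (ω : Fin d → ℝ) (hω : DampedForced.NonResonant ω) :
    ∃ ε₀ : ℝ, 0 < ε₀ ∧ ∃ C : ℝ, ∀ ε : ℝ, 0 < ε → ε ≤ ε₀ →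
      ∃ u : (Fin d → ℝ) → ℝ,
        AnalyticOnNhd ℝ u Set.univ ∧ DampedForced.TorusPeriodic u ∧ (∀ ψ, |u ψ| ≤ C * ε) ∧
        ∃ v₀ : ℝ → ℝ,
          DampedForced.IsSolutionOn ε g f ω Set.univ (fun t => c₀ + u (t • ω)) v₀ ∧
          ∃ U : Set (ℝ × ℝ),
            DampedForced.IsAttractedSet ε g f ω (fun t => c₀ + u (t • ω)) v₀ U ∧
            DampedForced.IsUniqueQuasiPeriodicIn ε g f ω (fun t => c₀ + u (t • ω)) U := by
  obtain ⟨r, hr, N, hN, hNg⟩ := DampedForced.exists_analytic_superposition (hg c₀ trivial)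
  obtain ⟨δ, hδ, hδr, G, hG, hGg⟩ :=
    DampedForced.exists_lipschitz_remainder (hg c₀ trivial) ha hr
  obtain ⟨M, F, hM, hF, hFf, hFM, hFP⟩ := DampedForced.exists_forcing hf hω
  set a := deriv g c₀
  have hfF : ∀ t : ℝ, f (t • ω) = F 0 t + DampedForced.torusMean f := fun t => by
    rw [hFf, zero_add, sub_add_cancel]
  have hfc : Continuous fun t : ℝ => f (t • ω) := by
    simp only [hfF]
    fun_prop
  have hfb : ∀ t : ℝ, |f (t • ω)| ≤ M + |DampedForced.torusMean f| := fun t => by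
    rw [hfF]
    exact (abs_add_le _ _).trans (add_le_add (((F 0).norm_coe_le_norm t).trans (hFM 0)) le_rfl)
  set D := M * (8 + 24 * a) with hD
  have hD0 : 0 ≤ D := by positivity
  -- The three bounds give respectively `κ ≥ 2`, real damping roots, and a response inside the ball
  -- of radius `δ / 7`. That radius makes the threshold `7r` equal to `δ`, where `G` still agrees
  -- with the remainder of `g`.
  refine ⟨min (min (1 / 2) (1 / (4 * a + 1))) (δ / 7 / (D + 1)), by positivity, 8 * M,
    fun ε hε hle => ?_⟩
  have hε1 : ε ≤ 1 / 2 := hle.trans ((min_le_left _ _).trans (min_le_left _ _))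
  have hε2 : ε * (4 * a + 1) ≤ 1 :=
    (le_div_iff₀ (by positivity)).1 (hle.trans ((min_le_left _ _).trans (min_le_right _ _)))
  have hε3 : ε * (D + 1) ≤ δ / 7 :=
    (le_div_iff₀ (by positivity)).1 (hle.trans (min_le_right _ _))
  have hκ : 2 ≤ ε⁻¹ := by
    rw [le_inv_comm₀ (by norm_num) hε]
    linarith
  have haκ : 4 * a ≤ ε⁻¹ ^ 2 := by
    rw [inv_pow, ← one_div, le_div_iff₀ (by positivity)]
    nlinarith [mul_pos hε ha]
  have hεD : ε * D < δ / 7 := by linarith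
  have hsub : Metric.ball (0 : BoundedContinuousFunction ℝ ℝ) δ ⊆ Metric.ball 0 r :=
    Metric.ball_subset_ball hδr.le
  obtain ⟨u, hu, hup, huM, v₀, hsol, hv₀⟩ := DampedForced.exists_response_solution hε ha hM
    (by linarith) haκ (by rw [← hD]; linarith : ε * (M * (8 + 24 * a)) < δ) hf hc₀ hF hFf hFM hFP
    hG hGg (hN.mono hsub) fun x hx => hNg x (hsub hx)
  have hatt : DampedForced.IsAttractedSet ε g f ω (fun t => c₀ + u (t • ω)) v₀
      (Metric.ball (c₀, (0 : ℝ)) (δ / 7)) := by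
    refine DampedForced.isAttractedSet_ball hε hfc hfb ha hκ haκ (by positivity) hG
      (fun y hy => hGg y (by linarith)) hsol (fun t => ?_) fun t => (hv₀ t).trans_lt hεD
    rw [add_sub_cancel_left]
    refine (huM _).trans_lt (lt_of_le_of_lt ?_ hεD)
    have : 0 ≤ ε * (M * (24 * a)) := by positivity
    rw [hD]
    linarith
  exact ⟨u, hu, hup, huM, v₀, hsol, _, hatt, hatt.isUniqueQuasiPeriodicIn
    (continuous_iff_continuousAt.2 fun ψ => (hu ψ trivial).continuousAt) hup⟩
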